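/- There is a universal constant $C>0$ with the following property. Let $d\ge 1$, let $\delta_1>\dots>\delta_d>0$ and let $c>0$. Then there is $n_0$, depending only on $c$, $d$ and $\delta_1,\dots,\delta_d$, such that the following holds for all $n>n_0$, all $\eta$ with $n^{-c}<\eta<1/2$, and every probability distribution $F$ on a set $\mathcal X\subset\mathbb R^d$ with $\langle x,x'\rangle\in[0,1]$ for all $x,x'\in\mathcal X$ whose second-moment matrix $\Delta=\mathbb E_{x\sim F}[xx^\top]$ has eigenvalues $\delta_1,\dots,\delta_d$. Let $(X,A)\sim\mathrm{RDPG}(F)$ on $n$ vertices: $X=[X_1,\dots,X_n]^\top\in\mathbb R^{n\times d}$ with $X_1,\dots,X_n$ i.i.d. with law $F$, $P=XX^\top$, and $A\in\{0,1\}^{n\times n}$ is symmetric with zero diagonal and, conditionally on $X$, has independent entries $A_{ij}\sim\mathrm{Bernoulli}(P_{ij})$ for $i<j$. Let $V,\hat V\in\mathbb R^{n\times d}$ have as columns orthonormal eigenvectors of $P$ and of $A$, respectively, for their $d$ eigenvalues of largest magnitude, in order of decreasing magnitude, with signs chosen so that $\langle V_{\cdot k},\hat V_{\cdot k}\rangle\ge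 0$ for every $k$. Then, with probability greater than $1-2\eta$ (simultaneously for all such choices of $V$ and $\hat V$), $$\|V^\top\hat V-I\|_F\le\frac{C\,d\,\log(n/\eta)}{\delta_d^2\,n}.$$ -/

import Mathlib

open MeasureTheory ProbabilityTheory
open scoped Matrix.Norms.Frobenius

/-- `F` is a probability distribution on some set `𝒳 ⊆ ℝ^d` all of whose pairwise inner products
(including those of a point with itself) lie in `[0, 1]`. -/
def IsLatentDistribution {d : ℕ} (F : Measure (EuclideanSpace ℝ (Fin d))) : Prop :=
  IsProbabilityMeasure F ∧
    ∃ 𝒳 : Set (EuclideanSpace ℝ (Fin d)), (∀ᵐ x ∂F, x ∈ 𝒳) ∧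
      ∀ x ∈ 𝒳, ∀ y ∈ 𝒳, inner ℝ x y ∈ Set.Icc (0 : ℝ) 1

/-- The second moment matrix `Δ = E[x xᵀ]`, `x ∼ F`. -/
noncomputable def secondMoment {d : ℕ} (F : Measure (EuclideanSpace ℝ (Fin d))) :
    Matrix (Fin d) (Fin d) ℝ :=
  Matrix.of fun k l => ∫ x, x k * x l ∂F

/-- The `n × d` matrix whose rows are the latent positions. -/
def latentMatrix {n d : ℕ} (x : Fin n → EuclideanSpace ℝ (Fin d)) : Matrix (Fin n) (Fin d) ℝ :=
  Matrix.of fun i k => x i k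

/-- The edge probability matrix `P = X Xᵀ`. -/
noncomputable def edgeProb {n d : ℕ} (x : Fin n → EuclideanSpace ℝ (Fin d)) :
    Matrix (Fin n) (Fin n) ℝ :=
  latentMatrix x * (latentMatrix x).transpose

/-- `(X, A) ∼ RDPG(F)` on `n` vertices. The rows of `X` are i.i.d. with law `F`; the matrix `A` is
symmetric, hollow and `0`-`1`-valued; and, conditionally on `X`, the entries `A i j`, `i < j`, are
independent Bernoulli variables with parameters `P i j`. The last condition is expressed by the
conditional probability given `X` of every pattern `a` of the entries above the diagonal. -/
structure IsRDPG {n d : ℕ} {Ω : Type*} [MeasurableSpace Ω] (μ : Measure Ω)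
    (F : Measure (EuclideanSpace ℝ (Fin d))) (X : Ω → Fin n → EuclideanSpace ℝ (Fin d))
    (A : Ω → Matrix (Fin n) (Fin n) ℝ) : Prop where
  measurable_latent : ∀ i, Measurable fun ω => X ω i
  law_latent : ∀ i, μ.map (fun ω => X ω i) = F
  indep_latent : iIndepFun (fun i ω => X ω i) μ
  measurable_adj : ∀ i j, Measurable fun ω => A ω i j
  zero_or_one : ∀ ω i j, A ω i j = 0 ∨ A ω i j = 1
  symm : ∀ ω, (A ω).IsSymm
  hollow : ∀ ω i, A ω i i = 0
  cond_law : ∀ a : Fin n → Fin n → Bool,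
    μ[Set.indicator {ω | ∀ i j, i < j → A ω i j = if a i j then 1 else 0} (fun _ => (1 : ℝ)) |
        MeasurableSpace.comap X inferInstance]
      =ᵐ[μ] fun ω => ∏ e : Fin n × Fin n with e.1 < e.2,
        if a e.1 e.2 then edgeProb (X ω) e.1 e.2 else 1 - edgeProb (X ω) e.1 e.2

/-- The columns of the `n × d` matrix `V` are orthonormal eigenvectors of the symmetric matrix `M`
belonging to its `d` eigenvalues of largest magnitude, in order of decreasing magnitude: they are
the first `d` columns of `U` for some full spectral decomposition `M = U diag(s) Uᵀ` with `U`
orthogonal and `|s 0| ≥ |s 1| ≥ …`. -/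
def IsTopEigenvectors {n d : ℕ} (M : Matrix (Fin n) (Fin n) ℝ) (V : Matrix (Fin n) (Fin d) ℝ) :
    Prop :=
  ∃ (h : d ≤ n) (U : Matrix (Fin n) (Fin n) ℝ) (s : Fin n → ℝ),
    U ∈ Matrix.orthogonalGroup (Fin n) ℝ ∧
    M = U * Matrix.diagonal s * U.transpose ∧
    Antitone (fun i => |s i|) ∧
    ∀ i j, V i j = U i (Fin.castLE h j)

/-! Put `E = A - P` and let `v_k`, `λ_k` and `v̂_l`, `λ̂_l` be the top eigenpairs of `P` and `A`.
Then `⟨v_k, E v̂_l⟩ = (λ̂_l - λ_k) ⟨v_k, v̂_l⟩`. As `XᵀX` concentrates around `n Δ` and `‖E‖ =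
O(√n)`, both spectra lie near `n δ_k`, and for `k ≠ l` the gap is of order `n`. Bounding the left
side by `‖E‖` would only give `n^(-1/2)`.

The gain comes from splitting `v̂_l` into its part in the span of the `v_m` and a residual `r`. On
the span, `v_m = X (Xᵀ v_m) / λ_m`, so `⟨v_k, E v_m⟩` is controlled by the `d × d` matrix `Xᵀ E X`.
Given `X`, its entries are, up to the diagonal of `P`, weighted sums of independent centred
Bernoulli variables, of size `n √(log n)` by Hoeffding; hence `⟨v_k, E v_m⟩ = O(√(log n))`. A
Davis–Kahan argument gives `‖r‖ = O(n^(-1/2))`, so `‖E r‖ = O(1)`. Off-diagonal entries of `VᵀV̂`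
are thus `O(√(log n) / n)` (`GramPerturbation.abs_inner_le`). A diagonal entry `c` lies in `[0, 1]`,
and `1 - c ≤ 1 - c²` is a sum of squared off-diagonal entries plus `‖r‖²`, so it is `O(1 / n)`
(`GramPerturbation.one_sub_inner_le`).

The implied constants depend on `d`, `δ` and `c`, but the claimed rate `log n / n` leaves a factor
`√(log n)` to absorb them once `n` is large, so `C = 1` works. The parameter `η` matters only
through `n^(-c) < η`: the exceptional event has probability at most `n^(-c)`
(`IsRDPG.measure_goodEvent_compl_le`, `eventually_failure_le`). -/

/-! ### Min-max bounds for eigenvalues by counting dimensions. -/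

section Spectral

open Module

variable {H K : Type*} [NormedAddCommGroup H] [InnerProductSpace ℝ H]
  [NormedAddCommGroup K] [InnerProductSpace ℝ K]

/-- Fewer linear functionals than the dimension have a common nonzero zero. -/
theorem exists_ne_zero_forall_functional_eq_zero [FiniteDimensional ℝ H] {ι : Type*} [Fintype ι]
    (f : ι → H →ₗ[ℝ] ℝ) (h : Fintype.card ι < finrank ℝ H) :
    ∃ y : H, y ≠ 0 ∧ ∀ i, f i y = 0 := by
  have hk : LinearMap.ker (LinearMap.pi f) ≠ ⊥ :=
    LinearMap.ker_ne_bot_of_finrank_lt (by simpa using h)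
  obtain ⟨y, hy, hy0⟩ := (Submodule.ne_bot_iff _).1 hk
  exact ⟨y, hy0, fun i => congrFun (LinearMap.mem_ker.1 hy) i⟩

theorem OrthonormalBasis.norm_sq_eq_sum_inner_sq {ι : Type*} [Fintype ι]
    (b : OrthonormalBasis ι ℝ H) (y : H) : ‖y‖ ^ 2 = ∑ i, (inner ℝ (b i) y) ^ 2 := by
  rw [← b.sum_sq_norm_inner_right y]
  simp [sq_abs]

section Diagonalized

variable {ι : Type*} [Fintype ι] {b : OrthonormalBasis ι ℝ H} {T : H →ₗ[ℝ] H} {s : ι → ℝ}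

theorem inner_basis_apply (hT : ∀ i, T (b i) = s i • b i) (i : ι) (y : H) :
    inner ℝ (b i) (T y) = s i * inner ℝ (b i) y := by
  classical
  conv_lhs => rw [← b.sum_repr' y, map_sum, inner_sum]
  simp only [map_smul, hT, inner_smul_right, orthonormal_iff_ite.1 b.orthonormal]
  simp [mul_comm]

theorem inner_self_apply_eq_sum (hT : ∀ i, T (b i) = s i • b i) (y : H) :
    inner ℝ y (T y) = ∑ i, s i * (inner ℝ (b i) y) ^ 2 := by
  rw [← b.sum_inner_mul_inner]
  refine Finset.sum_congr rfl fun i _ => ?_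
  rw [inner_basis_apply hT, real_inner_comm]
  ring

theorem norm_sq_apply_eq_sum (hT : ∀ i, T (b i) = s i • b i) (y : H) :
    ‖T y‖ ^ 2 = ∑ i, s i ^ 2 * (inner ℝ (b i) y) ^ 2 := by
  rw [b.norm_sq_eq_sum_inner_sq]
  simp [inner_basis_apply hT, mul_pow]

theorem inner_self_apply_le (hT : ∀ i, T (b i) = s i • b i) {y : H} {c : ℝ}
    (h : ∀ i, inner ℝ (b i) y ≠ 0 → s i ≤ c) : inner ℝ y (T y) ≤ c * ‖y‖ ^ 2 := by
  rw [inner_self_apply_eq_sum hT, b.norm_sq_eq_sum_inner_sq, Finset.mul_sum]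
  refine Finset.sum_le_sum fun i _ => ?_
  by_cases hi : inner ℝ (b i) y = 0
  · simp [hi]
  · exact mul_le_mul_of_nonneg_right (h i hi) (sq_nonneg _)

theorem le_inner_self_apply (hT : ∀ i, T (b i) = s i • b i) {y : H} {c : ℝ}
    (h : ∀ i, inner ℝ (b i) y ≠ 0 → c ≤ s i) : c * ‖y‖ ^ 2 ≤ inner ℝ y (T y) := by
  rw [inner_self_apply_eq_sum hT, b.norm_sq_eq_sum_inner_sq, Finset.mul_sum]
  refine Finset.sum_le_sum fun i _ => ?_
  by_cases hi : inner ℝ (b i) y = 0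
  · simp [hi]
  · exact mul_le_mul_of_nonneg_right (h i hi) (sq_nonneg _)

theorem norm_apply_le (hT : ∀ i, T (b i) = s i • b i) {y : H} {c : ℝ} (hc : 0 ≤ c)
    (h : ∀ i, inner ℝ (b i) y ≠ 0 → |s i| ≤ c) : ‖T y‖ ≤ c * ‖y‖ := by
  refine abs_le_of_sq_le_sq' ?_ (by positivity) |>.2
  rw [norm_sq_apply_eq_sum hT, mul_pow, b.norm_sq_eq_sum_inner_sq, Finset.mul_sum]
  refine Finset.sum_le_sum fun i _ => ?_
  by_cases hi : inner ℝ (b i) y = 0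
  · simp [hi]
  · refine mul_le_mul_of_nonneg_right ?_ (sq_nonneg _)
    rw [← sq_abs]
    exact pow_le_pow_left₀ (abs_nonneg _) (h i hi) 2

theorem le_norm_apply (hT : ∀ i, T (b i) = s i • b i) {y : H} {c : ℝ} (hc : 0 ≤ c)
    (h : ∀ i, inner ℝ (b i) y ≠ 0 → c ≤ |s i|) : c * ‖y‖ ≤ ‖T y‖ := by
  refine abs_le_of_sq_le_sq' ?_ (by positivity) |>.2
  rw [norm_sq_apply_eq_sum hT, mul_pow, b.norm_sq_eq_sum_inner_sq, Finset.mul_sum]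
  refine Finset.sum_le_sum fun i _ => ?_
  by_cases hi : inner ℝ (b i) y = 0
  · simp [hi]
  · refine mul_le_mul_of_nonneg_right ?_ (sq_nonneg _)
    rw [← sq_abs (s i)]
    exact pow_le_pow_left₀ hc (h i hi) 2

end Diagonalized

variable {n d : ℕ}

/-- Weyl's inequality for the moduli of the eigenvalues of diagonalized operators. -/
theorem abs_eigenvalue_le_add {b b' : OrthonormalBasis (Fin n) ℝ H} {T T' : H →ₗ[ℝ] H}
    {s s' : Fin n → ℝ} (hT : ∀ i, T (b i) = s i • b i) (hT' : ∀ i, T' (b' i) = s' i • b' i)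
    (hs : Antitone fun i => |s i|) (hs' : Antitone fun i => |s' i|) {ε : ℝ}
    (hε : ∀ x, ‖T' x - T x‖ ≤ ε * ‖x‖) (k : Fin n) : |s' k| ≤ |s k| + ε := by
  have := b.toBasis.finiteDimensional_of_finite
  -- Only `n - 1` conditions: `y` is orthogonal to `b i` for `i < k`, where `T` is large, and to `b'
  -- i` for `i > k`, where `T'` is small.
  obtain ⟨y, hy, h⟩ := exists_ne_zero_forall_functional_eq_zero
    (fun i : {i : Fin n // i ≠ k} =>
      if i.1 < k then innerₛₗ ℝ (b i.1) else innerₛₗ ℝ (b' i.1))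
    (by
      rw [finrank_eq_card_basis b.toBasis, Fintype.card_subtype_compl]
      simpa using Fin.pos k)
  have h1 : ‖T y‖ ≤ |s k| * ‖y‖ := by
    refine norm_apply_le hT (abs_nonneg _) fun i hi => hs ?_
    by_contra hlt
    rw [not_le] at hlt
    exact hi (by simpa [hlt] using h ⟨i, hlt.ne⟩)
  have h2 : |s' k| * ‖y‖ ≤ ‖T' y‖ := by
    refine le_norm_apply hT' (abs_nonneg _) fun i hi => hs' ?_
    by_contra hlt
    rw [not_le] at hlt
    exact hi (by simpa [hlt.not_gt] using h ⟨i, hlt.ne'⟩)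
  have h3 : ‖T' y‖ ≤ ‖T y‖ + ε * ‖y‖ := by
    have := norm_add_le (T y) (T' y - T y)
    rw [add_sub_cancel] at this
    linarith [hε y]
  have hpos : 0 < ‖y‖ := norm_pos_iff.2 hy
  refine le_of_mul_le_mul_right ?_ hpos
  linarith

section Gram

variable {b : OrthonormalBasis (Fin n) ℝ H} {q : OrthonormalBasis (Fin d) ℝ K}
  {X : K →ₗ[ℝ] H} {Xt : H →ₗ[ℝ] K} {s : Fin n → ℝ}

theorem norm_sq_adjoint_basis (hadj : ∀ x y, inner ℝ (X x) y = inner ℝ x (Xt y))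
    (hP : ∀ i, X (Xt (b i)) = s i • b i) (i : Fin n) : ‖Xt (b i)‖ ^ 2 = s i := by
  rw [← real_inner_self_eq_norm_sq, ← hadj, hP, inner_smul_left, real_inner_self_eq_norm_sq]
  simp

theorem gram_eigenvalue_nonneg (hadj : ∀ x y, inner ℝ (X x) y = inner ℝ x (Xt y))
    (hP : ∀ i, X (Xt (b i)) = s i • b i) (i : Fin n) : 0 ≤ s i := by
  rw [← norm_sq_adjoint_basis hadj hP i]
  positivity

/-- Courant–Fischer for `X Xt`, tested on the side of `Xt X`: this carries spectral information from
the fixed dimension `d` to dimension `n`. For `d ≤ k` the hypothesis only concerns `x = 0`, so `c =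
0` is allowed. -/
theorem gram_eigenvalue_le (q : OrthonormalBasis (Fin d) ℝ K)
    (hadj : ∀ x y, inner ℝ (X x) y = inner ℝ x (Xt y))
    (hP : ∀ i, X (Xt (b i)) = s i • b i) (hs : Antitone s) (k : Fin n) {c : ℝ} (hc : 0 ≤ c)
    (h : ∀ x, (∀ j : Fin d, j.1 < k.1 → inner ℝ (q j) x = 0) → ‖X x‖ ^ 2 ≤ c * ‖x‖ ^ 2) :
    s k ≤ c := by
  have := b.toBasis.finiteDimensional_of_finite
  obtain ⟨y, hy, hy'⟩ := exists_ne_zero_forall_functional_eq_zero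
    -- For `d ≤ i < k` there is no `q i`; the functional used there is a mere filler.
    (fun i : {i : Fin n // i ≠ k} =>
      if hi : i.1 < k ∧ i.1.1 < d then (innerₛₗ ℝ (q ⟨i.1.1, hi.2⟩)).comp Xt
      else innerₛₗ ℝ (b i.1))
    (by
      rw [finrank_eq_card_basis b.toBasis, Fintype.card_subtype_compl]
      simpa using Fin.pos k)
  have hX := h (Xt y) fun j hj => by
    simpa [Fin.lt_def, hj] using hy' ⟨⟨j.1, hj.trans k.2⟩, by simp [Fin.ext_iff, hj.ne]⟩
  have hlow : s k * ‖y‖ ^ 2 ≤ inner ℝ y ((X ∘ₗ Xt) y) := by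
    refine le_inner_self_apply (b := b) (T := X ∘ₗ Xt) (s := s) hP fun i hi => hs ?_
    by_contra hlt
    rw [not_le] at hlt
    exact hi (by simpa [hlt.not_gt] using hy' ⟨i, hlt.ne'⟩)
  have hin : inner ℝ y ((X ∘ₗ Xt) y) = ‖Xt y‖ ^ 2 := by
    rw [LinearMap.comp_apply, real_inner_comm, hadj, real_inner_self_eq_norm_sq]
  rw [hin] at hlow
  have hpos : 0 < ‖y‖ := norm_pos_iff.2 hy
  rcases eq_or_ne (Xt y) 0 with h0 | h0
  · rw [h0] at hlow
    have : s k * ‖y‖ ^ 2 ≤ 0 := by simpa using hlow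
    exact (nonpos_of_mul_nonpos_left this (by positivity)).trans hc
  · have hx : 0 < ‖Xt y‖ := norm_pos_iff.2 h0
    have hcs : ‖Xt y‖ ^ 2 ≤ ‖y‖ * ‖X (Xt y)‖ := by
      rw [← hin]; exact real_inner_le_norm _ _
    have h4 : (‖Xt y‖ ^ 2) ^ 2 ≤ ‖y‖ ^ 2 * (c * ‖Xt y‖ ^ 2) := by
      calc (‖Xt y‖ ^ 2) ^ 2 ≤ (‖y‖ * ‖X (Xt y)‖) ^ 2 := pow_le_pow_left₀ (by positivity) hcs 2
        _ = ‖y‖ ^ 2 * ‖X (Xt y)‖ ^ 2 := by ring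
        _ ≤ _ := by gcongr
    have h5 : ‖Xt y‖ ^ 2 ≤ c * ‖y‖ ^ 2 := by
      refine le_of_mul_le_mul_right ?_ (pow_pos hx 2)
      linarith
    refine le_of_mul_le_mul_right (hlow.trans h5) (by positivity)

theorem le_gram_eigenvalue (q : OrthonormalBasis (Fin d) ℝ K)
    (hadj : ∀ x y, inner ℝ (X x) y = inner ℝ x (Xt y))
    (hP : ∀ i, X (Xt (b i)) = s i • b i) (hs : Antitone s) (hdn : d ≤ n) (k : Fin d) {c : ℝ}
    (hc : 0 < c) (h : ∀ x, (∀ j, k < j → inner ℝ (q j) x = 0) → c * ‖x‖ ^ 2 ≤ ‖X x‖ ^ 2) :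
    c ≤ s (Fin.castLE hdn k) := by
  have := q.toBasis.finiteDimensional_of_finite
  obtain ⟨x, hx, hx'⟩ := exists_ne_zero_forall_functional_eq_zero
    (fun i : {i : Fin d // i ≠ k} =>
      if i.1 < k then (innerₛₗ ℝ (b (Fin.castLE hdn i.1))).comp X else innerₛₗ ℝ (q i.1))
    (by
      rw [finrank_eq_card_basis q.toBasis, Fintype.card_subtype_compl]
      simpa using Fin.pos k)
  have hX := h x fun j hj => by simpa [hj.not_gt] using hx' ⟨j, hj.ne'⟩
  have hup : inner ℝ (X x) ((X ∘ₗ Xt) (X x)) ≤ s (Fin.castLE hdn k) * ‖X x‖ ^ 2 := by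
    refine inner_self_apply_le (b := b) (T := X ∘ₗ Xt) (s := s) hP fun i hi => hs ?_
    by_contra hlt
    rw [not_le] at hlt
    have hik : i.1 < k.1 := hlt
    refine hi ?_
    have h1 := hx' ⟨⟨i.1, hik.trans k.2⟩, by simp [Fin.ext_iff, hik.ne]⟩
    simpa [Fin.lt_def, hik] using h1
  rw [LinearMap.comp_apply, real_inner_comm, hadj, real_inner_self_eq_norm_sq] at hup
  have hpos : 0 < ‖x‖ := norm_pos_iff.2 hx
  have hXpos : 0 < ‖X x‖ ^ 2 := lt_of_lt_of_le (by positivity) hX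
  have hcs : ‖X x‖ ^ 2 ≤ ‖x‖ * ‖Xt (X x)‖ := by
    rw [← real_inner_self_eq_norm_sq, hadj]; exact real_inner_le_norm _ _
  have h4 : (‖X x‖ ^ 2) ^ 2 ≤ ‖x‖ ^ 2 * (s (Fin.castLE hdn k) * ‖X x‖ ^ 2) := by
    calc (‖X x‖ ^ 2) ^ 2 ≤ (‖x‖ * ‖Xt (X x)‖) ^ 2 := pow_le_pow_left₀ (by positivity) hcs 2
      _ = ‖x‖ ^ 2 * ‖Xt (X x)‖ ^ 2 := by ring
      _ ≤ _ := by gcongr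
  have h5 : ‖X x‖ ^ 2 ≤ s (Fin.castLE hdn k) * ‖x‖ ^ 2 := by
    refine le_of_mul_le_mul_right ?_ hXpos
    linarith
  exact le_of_mul_le_mul_right (hX.trans h5) (by positivity)

end Gram

end Spectral

/-! ### Deterministic perturbation of the eigenvectors of a Gram operator. -/

section Perturbation

open Module

variable {H K : Type*} [NormedAddCommGroup H] [InnerProductSpace ℝ H]
  [NormedAddCommGroup K] [InnerProductSpace ℝ K] {n d : ℕ}

theorem card_filter_val_lt_le (n d : ℕ) :
    (Finset.univ.filter fun i : Fin n => i.1 < d).card ≤ d := by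
  have := Finset.card_le_card_of_injOn (s := Finset.univ.filter fun i : Fin n => i.1 < d)
    (t := Finset.range d) Fin.val (fun i hi => by simpa using hi)
    (fun _ _ _ _ h => Fin.ext h)
  simpa using this

/-- The data of a Gram operator `X Xᵀ` with eigenbasis `b`, whose companion `Xᵀ X` is close to
`N • D` with `D` diagonalized by `q` with `8 ε`-separated positive eigenvalues `δ`, and of an
operator `TA` with eigenbasis `bh` within distance `ρ ≤ N ε` of `X Xᵀ`. -/
structure GramPerturbation (b bh : OrthonormalBasis (Fin n) ℝ H) (q : OrthonormalBasis (Fin d) ℝ K)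
    (X : K →ₗ[ℝ] H) (Xt : H →ₗ[ℝ] K) (TA : H →ₗ[ℝ] H) (D : K →ₗ[ℝ] K) (s sh : Fin n → ℝ)
    (δ : Fin d → ℝ) (N ε ρ τ : ℝ) : Prop where
  le_dim : d ≤ n
  adj : ∀ x y, inner ℝ (X x) y = inner ℝ x (Xt y)
  eigen_gram : ∀ i, X (Xt (b i)) = s i • b i
  eigen_pert : ∀ i, TA (bh i) = sh i • bh i
  anti_gram : Antitone fun i => |s i|
  anti_pert : Antitone fun i => |sh i|
  eigen_moment : ∀ k, D (q k) = δ k • q k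
  N_pos : 0 < N
  ε_pos : 0 < ε
  le_δ : ∀ k, 8 * ε ≤ δ k
  gap : ∀ k l, k < l → δ l + 8 * ε ≤ δ k
  moment_close : ∀ x, |‖X x‖ ^ 2 - N * inner ℝ x (D x)| ≤ N * ε * ‖x‖ ^ 2
  pert_le : ∀ x, ‖TA x - X (Xt x)‖ ≤ ρ * ‖x‖
  ρ_nonneg : 0 ≤ ρ
  ρ_le : ρ ≤ N * ε
  τ_nonneg : 0 ≤ τ
  -- The decisive hypothesis: on the range of `X` the noise is controlled by a separate parameter
  -- `τ`, which in the application is far smaller than `ρ` would suggest.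
  form_le : ∀ x y, |inner ℝ (X x) (TA (X y) - X (Xt (X y)))| ≤ τ * N * ‖x‖ * ‖y‖

namespace GramPerturbation

variable {b bh : OrthonormalBasis (Fin n) ℝ H} {q : OrthonormalBasis (Fin d) ℝ K}
  {X : K →ₗ[ℝ] H} {Xt : H →ₗ[ℝ] K} {TA : H →ₗ[ℝ] H} {D : K →ₗ[ℝ] K} {s sh : Fin n → ℝ}
  {δ : Fin d → ℝ} {N ε ρ τ : ℝ}

theorem antitone_δ (h : GramPerturbation b bh q X Xt TA D s sh δ N ε ρ τ) : Antitone δ := by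
  intro k l hkl
  rcases hkl.eq_or_lt with rfl | hlt
  · exact le_rfl
  · linarith [h.gap k l hlt, h.ε_pos]

theorem s_nonneg (h : GramPerturbation b bh q X Xt TA D s sh δ N ε ρ τ) (i : Fin n) : 0 ≤ s i :=
  gram_eigenvalue_nonneg h.adj h.eigen_gram i

theorem antitone_s (h : GramPerturbation b bh q X Xt TA D s sh δ N ε ρ τ) : Antitone s := by
  intro i j hij
  simpa [abs_of_nonneg (h.s_nonneg _)] using h.anti_gram hij

theorem s_le (h : GramPerturbation b bh q X Xt TA D s sh δ N ε ρ τ) (k : Fin d) :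
    s (Fin.castLE h.le_dim k) ≤ N * δ k + N * ε := by
  have hN := h.N_pos
  have hε := h.ε_pos
  have hδ := h.le_δ k
  refine gram_eigenvalue_le q h.adj h.eigen_gram h.antitone_s _ ?_ fun x hx => ?_
  · have : 0 < δ k := by linarith
    positivity
  · have h1 : inner ℝ x (D x) ≤ δ k * ‖x‖ ^ 2 := by
      refine inner_self_apply_le h.eigen_moment fun i hi => h.antitone_δ ?_
      by_contra hlt
      exact hi (hx i (not_le.1 hlt))
    have h2 := (abs_le.1 (h.moment_close x)).2
    have h3 := mul_le_mul_of_nonneg_left h1 hN.le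
    linarith

theorem le_s (h : GramPerturbation b bh q X Xt TA D s sh δ N ε ρ τ) (k : Fin d) :
    N * δ k - N * ε ≤ s (Fin.castLE h.le_dim k) := by
  have hN := h.N_pos
  have hε := h.ε_pos
  have hδ := h.le_δ k
  refine le_gram_eigenvalue q h.adj h.eigen_gram h.antitone_s _ _ ?_ fun x hx => ?_
  · have : 0 < N * (δ k - ε) := mul_pos hN (by linarith)
    linarith
  · have h1 : δ k * ‖x‖ ^ 2 ≤ inner ℝ x (D x) := by
      refine le_inner_self_apply h.eigen_moment fun i hi => h.antitone_δ ?_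
      by_contra hlt
      exact hi (hx i (not_le.1 hlt))
    have h2 := (abs_le.1 (h.moment_close x)).1
    have h3 := mul_le_mul_of_nonneg_left h1 hN.le
    linarith

theorem s_eq_zero (h : GramPerturbation b bh q X Xt TA D s sh δ N ε ρ τ) (i : Fin n)
    (hi : d ≤ i.1) : s i = 0 := by
  refine le_antisymm ?_ (h.s_nonneg i)
  refine gram_eigenvalue_le q h.adj h.eigen_gram h.antitone_s i le_rfl fun x hx => ?_
  have hx0 : x = 0 := by
    rw [← norm_eq_zero, ← sq_eq_zero_iff, q.norm_sq_eq_sum_inner_sq]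
    exact Finset.sum_eq_zero fun j _ => by rw [hx j (j.2.trans_le hi)]; simp
  simp [hx0]

/-- Weyl's inequality here compares moduli only, so the sign of `sh` has to be settled. As `X Xt` is
nonnegative, `sh ≥ -ρ`; a negative `sh` would force `s ≤ 2 ρ ≤ 2 N ε`, whereas `s ≥ 7 N ε`. -/
theorem abs_sh_sub_s_le (h : GramPerturbation b bh q X Xt TA D s sh δ N ε ρ τ) (k : Fin d) :
    |sh (Fin.castLE h.le_dim k) - s (Fin.castLE h.le_dim k)| ≤ N * ε := by
  set i := Fin.castLE h.le_dim k
  have hNε : 0 < N * ε := mul_pos h.N_pos h.ε_pos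
  have hP : ∀ i, (X ∘ₗ Xt) (b i) = s i • b i := h.eigen_gram
  have h1 : |sh i| ≤ |s i| + ρ :=
    abs_eigenvalue_le_add hP h.eigen_pert h.anti_gram h.anti_pert h.pert_le i
  have h2 : |s i| ≤ |sh i| + ρ :=
    abs_eigenvalue_le_add h.eigen_pert hP h.anti_pert h.anti_gram
      (fun x => by rw [norm_sub_rev]; exact h.pert_le x) i
  rw [abs_of_nonneg (h.s_nonneg i)] at h1 h2
  have h3 : -ρ ≤ sh i := by
    have e1 : inner ℝ (bh i) (TA (bh i) - X (Xt (bh i))) = sh i - ‖Xt (bh i)‖ ^ 2 := by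
      rw [inner_sub_right, h.eigen_pert, inner_smul_right, real_inner_self_eq_norm_sq,
        real_inner_comm, h.adj, real_inner_self_eq_norm_sq]
      simp
    have e2 := abs_real_inner_le_norm (bh i) (TA (bh i) - X (Xt (bh i)))
    have e3 := h.pert_le (bh i)
    rw [e1] at e2
    simp only [OrthonormalBasis.norm_eq_one, one_mul, mul_one] at e2 e3
    nlinarith [(abs_le.1 e2).1, sq_nonneg ‖Xt (bh i)‖]
  have h4 : N * (8 * ε) ≤ N * δ k := mul_le_mul_of_nonneg_left (h.le_δ k) h.N_pos.le
  have h5 := h.le_s k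
  have h6 := h.ρ_le
  have h7 : 0 ≤ sh i := by
    by_contra hneg
    rw [not_le] at hneg
    rw [abs_of_neg hneg] at h2
    linarith
  rw [abs_of_nonneg h7] at h1 h2
  rw [abs_le]
  constructor <;> linarith

theorem le_s_top (h : GramPerturbation b bh q X Xt TA D s sh δ N ε ρ τ) (k : Fin d) :
    N * ε ≤ s (Fin.castLE h.le_dim k) := by
  have hNε : 0 < N * ε := mul_pos h.N_pos h.ε_pos
  have h4 : N * (8 * ε) ≤ N * δ k := mul_le_mul_of_nonneg_left (h.le_δ k) h.N_pos.le
  linarith [h.le_s k]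

theorem le_sh_top (h : GramPerturbation b bh q X Xt TA D s sh δ N ε ρ τ) (k : Fin d) :
    N * ε ≤ sh (Fin.castLE h.le_dim k) := by
  have hNε : 0 < N * ε := mul_pos h.N_pos h.ε_pos
  have h4 : N * (8 * ε) ≤ N * δ k := mul_le_mul_of_nonneg_left (h.le_δ k) h.N_pos.le
  linarith [h.le_s k, (abs_le.1 (h.abs_sh_sub_s_le k)).1]

theorem le_abs_gap (h : GramPerturbation b bh q X Xt TA D s sh δ N ε ρ τ) {k l : Fin d}
    (hkl : k ≠ l) :
    N * ε ≤ |sh (Fin.castLE h.le_dim l) - s (Fin.castLE h.le_dim k)| := by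
  have hNε : 0 < N * ε := mul_pos h.N_pos h.ε_pos
  have hl := abs_le.1 (h.abs_sh_sub_s_le l)
  rcases lt_or_gt_of_ne hkl with hlt | hlt
  · have h4 := mul_le_mul_of_nonneg_left (h.gap k l hlt) h.N_pos.le
    refine le_trans ?_ (neg_le_abs _)
    linarith [h.le_s k, h.s_le l, hl.2]
  · have h4 := mul_le_mul_of_nonneg_left (h.gap l k hlt) h.N_pos.le
    refine le_trans ?_ (le_abs_self _)
    linarith [h.le_s l, h.s_le k, hl.1]

/-- Davis–Kahan for the residual: `s i = 0` beyond index `d`, so there the noise applied to `bh l`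
has coefficients `sh l * ⟨b i, bh l⟩`, with `sh l ≥ N ε`. -/
theorem sum_residual_sq_le (h : GramPerturbation b bh q X Xt TA D s sh δ N ε ρ τ) (l : Fin d) :
    ∑ i : Fin n with ¬ i.1 < d, (inner ℝ (b i) (bh (Fin.castLE h.le_dim l))) ^ 2 ≤
      (ρ / (N * ε)) ^ 2 := by
  set v := bh (Fin.castLE h.le_dim l) with hv
  have hNε : 0 < N * ε := mul_pos h.N_pos h.ε_pos
  have hP : ∀ i, (X ∘ₗ Xt) (b i) = s i • b i := h.eigen_gram
  rw [div_pow, le_div_iff₀ (by positivity), Finset.sum_mul]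
  calc ∑ i : Fin n with ¬ i.1 < d, inner ℝ (b i) v ^ 2 * (N * ε) ^ 2
      ≤ ∑ i : Fin n with ¬ i.1 < d, inner ℝ (b i) (TA v - X (Xt v)) ^ 2 := by
        refine Finset.sum_le_sum fun i hi => ?_
        have e1 : inner ℝ (b i) (X (Xt v)) = s i * inner ℝ (b i) v := inner_basis_apply hP i v
        rw [inner_sub_right, e1, h.s_eq_zero i (by simpa using hi), hv, h.eigen_pert,
          inner_smul_right, zero_mul, sub_zero, mul_pow (sh _), mul_comm]
        exact mul_le_mul_of_nonneg_right (pow_le_pow_left₀ hNε.le (h.le_sh_top l) 2) (sq_nonneg _)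
    _ ≤ ∑ i, inner ℝ (b i) (TA v - X (Xt v)) ^ 2 :=
        Finset.sum_le_sum_of_subset_of_nonneg (Finset.filter_subset _ _) fun _ _ _ => sq_nonneg _
    _ = ‖TA v - X (Xt v)‖ ^ 2 := (b.norm_sq_eq_sum_inner_sq _).symm
    _ ≤ ρ ^ 2 := by
        have := h.pert_le v
        rw [hv, OrthonormalBasis.norm_eq_one, mul_one, ← hv] at this
        gcongr

/-- Substitute `b k = X (Xt (b k)) / s k` in `form_le`. Since `‖Xt (b k)‖² = s k`, the bound becomes
`τ N / √(s k * s m)`, and both eigenvalues are at least `N ε`. -/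
theorem abs_form_basis_le (h : GramPerturbation b bh q X Xt TA D s sh δ N ε ρ τ) (k m : Fin d) :
    |inner ℝ (b (Fin.castLE h.le_dim k))
      (TA (b (Fin.castLE h.le_dim m)) - X (Xt (b (Fin.castLE h.le_dim m))))| ≤ τ / ε := by
  have hNε : 0 < N * ε := mul_pos h.N_pos h.ε_pos
  have hk := h.le_s_top k
  have hm := h.le_s_top m
  have nk := norm_sq_adjoint_basis h.adj h.eigen_gram (Fin.castLE h.le_dim k)
  have nm := norm_sq_adjoint_basis h.adj h.eigen_gram (Fin.castLE h.le_dim m)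
  have ek := h.eigen_gram (Fin.castLE h.le_dim k)
  have em := h.eigen_gram (Fin.castLE h.le_dim m)
  set u := b (Fin.castLE h.le_dim k)
  set v := b (Fin.castLE h.le_dim m)
  have hf := h.form_le (Xt u) (Xt v)
  rw [ek, em, map_smul, map_smul, map_smul, ← smul_sub, inner_smul_left, inner_smul_right] at hf
  have pk : 0 < ‖Xt u‖ := by
    by_contra hcon
    have : ‖Xt u‖ = 0 := le_antisymm (not_lt.1 hcon) (norm_nonneg _)
    rw [this] at nk; norm_num at nk; linarith
  have pm : 0 < ‖Xt v‖ := by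
    by_contra hcon
    have : ‖Xt v‖ = 0 := le_antisymm (not_lt.1 hcon) (norm_nonneg _)
    rw [this] at nm; norm_num at nm; linarith
  rw [← nk] at hk
  rw [← nm] at hm
  rw [← nk, ← nm, abs_mul, abs_mul] at hf
  simp only [conj_trivial, abs_pow, abs_norm] at hf
  set z := |inner ℝ u (TA v - X (Xt v))|
  have hz : ‖Xt u‖ * ‖Xt v‖ * z ≤ τ * N := by
    refine le_of_mul_le_mul_right ?_ (mul_pos pk pm)
    linarith
  have hprod : N * ε ≤ ‖Xt u‖ * ‖Xt v‖ := by
    refine (abs_le_of_sq_le_sq' ?_ (by positivity)).2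
    rw [sq (N * ε), mul_pow ‖Xt u‖]
    exact mul_le_mul hk hm hNε.le (by positivity)
  have hz2 : N * ε * z ≤ τ * N := (mul_le_mul_of_nonneg_right hprod (abs_nonneg _)).trans hz
  rw [le_div_iff₀ h.ε_pos]
  refine le_of_mul_le_mul_right ?_ h.N_pos
  linarith

theorem abs_inner_le (h : GramPerturbation b bh q X Xt TA D s sh δ N ε ρ τ) {k l : Fin d}
    (hkl : k ≠ l) :
    |inner ℝ (b (Fin.castLE h.le_dim k)) (bh (Fin.castLE h.le_dim l))| ≤
      (d * (τ / ε) + ρ * (ρ / (N * ε))) / (N * ε) := by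
  have hNε : 0 < N * ε := mul_pos h.N_pos h.ε_pos
  have hP : ∀ i, (X ∘ₗ Xt) (b i) = s i • b i := h.eigen_gram
  have hres := h.sum_residual_sq_le l
  have hgap := h.le_abs_gap hkl
  have hA := h.eigen_pert (Fin.castLE h.le_dim l)
  set v := bh (Fin.castLE h.le_dim l) with hv
  have hv1 : ‖v‖ = 1 := by simp [hv]
  set u := b (Fin.castLE h.le_dim k) with hu
  have hu1 : ‖u‖ = 1 := by simp [hu]
  let E : H →ₗ[ℝ] H := TA - X ∘ₗ Xt
  have hEE : ∀ x, E x = TA x - X (Xt x) := fun x => rfl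
  -- The top part of `v` meets the fine bound `τ / ε`; the residual `r` is small enough for the
  -- operator norm bound `ρ`.
  set r := ∑ i : Fin n with ¬ i.1 < d, inner ℝ (b i) v • b i with hr
  have hvr : v = (∑ i : Fin n with i.1 < d, inner ℝ (b i) v • b i) + r := by
    rw [hr, Finset.sum_filter_add_sum_filter_not, b.sum_repr']
  have hrn : ‖r‖ ≤ ρ / (N * ε) := by
    refine (abs_le_of_sq_le_sq' ?_ (div_nonneg h.ρ_nonneg hNε.le)).2
    refine le_trans (le_of_eq ?_) hres
    rw [← real_inner_self_eq_norm_sq, hr, b.orthonormal.inner_sum]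
    simp [sq]
  have hmain : inner ℝ u (E v) =
      (sh (Fin.castLE h.le_dim l) - s (Fin.castLE h.le_dim k)) * inner ℝ u v := by
    have e1 : inner ℝ u (X (Xt v)) = s (Fin.castLE h.le_dim k) * inner ℝ u v :=
      inner_basis_apply hP _ v
    rw [hEE, inner_sub_right, e1, hA, inner_smul_right]
    ring
  have hb : |inner ℝ u (E v)| ≤ d * (τ / ε) + ρ * (ρ / (N * ε)) := by
    have e1 : inner ℝ u (E v) = (∑ i : Fin n with i.1 < d, inner ℝ (b i) v * inner ℝ u (E (b i)))
        + inner ℝ u (E r) := by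
      conv_lhs => rw [hvr, map_add, map_sum, inner_add_right, inner_sum]
      simp [inner_smul_right]
    rw [e1]
    refine (abs_add_le _ _).trans (add_le_add ?_ ?_)
    · refine (Finset.abs_sum_le_sum_abs _ _).trans ?_
      have hterm : ∀ i ∈ Finset.univ.filter (fun i : Fin n => i.1 < d),
          |inner ℝ (b i) v * inner ℝ u (E (b i))| ≤ τ / ε := by
        intro i hi
        have hid : i.1 < d := by simpa using hi
        have f1 : |inner ℝ (b i) v| ≤ 1 := by
          simpa [hv1] using abs_real_inner_le_norm (b i) v
        have f2 := h.abs_form_basis_le k ⟨i.1, hid⟩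
        have f3 : Fin.castLE h.le_dim ⟨i.1, hid⟩ = i := rfl
        rw [f3, ← hEE] at f2
        rw [abs_mul]
        calc _ ≤ 1 * (τ / ε) := mul_le_mul f1 f2 (abs_nonneg _) zero_le_one
          _ = _ := one_mul _
      refine (Finset.sum_le_card_nsmul _ _ _ hterm).trans ?_
      rw [nsmul_eq_mul]
      have : 0 ≤ τ / ε := div_nonneg h.τ_nonneg h.ε_pos.le
      gcongr
      exact card_filter_val_lt_le n d
    · refine (abs_real_inner_le_norm _ _).trans ?_
      rw [hu1, one_mul]
      exact (h.pert_le r).trans (mul_le_mul_of_nonneg_left hrn h.ρ_nonneg)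
  rw [le_div_iff₀ hNε]
  rw [hmain, abs_mul] at hb
  refine le_trans ?_ hb
  rw [mul_comm]
  exact mul_le_mul_of_nonneg_right hgap (abs_nonneg _)

theorem one_sub_inner_le (h : GramPerturbation b bh q X Xt TA D s sh δ N ε ρ τ) {k : Fin d}
    (hk : 0 ≤ inner ℝ (b (Fin.castLE h.le_dim k)) (bh (Fin.castLE h.le_dim k))) :
    |inner ℝ (b (Fin.castLE h.le_dim k)) (bh (Fin.castLE h.le_dim k)) - 1| ≤
      d * ((d * (τ / ε) + ρ * (ρ / (N * ε))) / (N * ε)) ^ 2 + (ρ / (N * ε)) ^ 2 := by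
  have hres := h.sum_residual_sq_le k
  set κ := (d * (τ / ε) + ρ * (ρ / (N * ε))) / (N * ε) with hκ
  set i₀ := Fin.castLE h.le_dim k with hi₀
  set c := inner ℝ (b i₀) (bh i₀) with hc
  have hc1 : c ≤ 1 := by simpa [hc] using real_inner_le_norm (b i₀) (bh i₀)
  have hone : (1 : ℝ) = ∑ i, (inner ℝ (b i) (bh i₀)) ^ 2 := by
    rw [← b.norm_sq_eq_sum_inner_sq]; simp
  rw [← Finset.sum_filter_add_sum_filter_not _ (fun i : Fin n => i.1 < d)] at hone
  have hmem : i₀ ∈ Finset.univ.filter (fun i : Fin n => i.1 < d) := by simp [hi₀]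
  rw [← Finset.add_sum_erase _ _ hmem] at hone
  have hsum : ∑ i ∈ (Finset.univ.filter (fun i : Fin n => i.1 < d)).erase i₀,
      (inner ℝ (b i) (bh i₀)) ^ 2 ≤ d * κ ^ 2 := by
    refine (Finset.sum_le_card_nsmul _ _ (κ ^ 2) fun i hi => ?_).trans ?_
    · have hid : i.1 < d := by simpa using (Finset.mem_erase.1 hi).2
      have hne : (⟨i.1, hid⟩ : Fin d) ≠ k := by
        intro he
        apply (Finset.mem_erase.1 hi).1
        rw [hi₀, ← he]
        rfl
      have := h.abs_inner_le hne
      rw [← sq_abs]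
      exact pow_le_pow_left₀ (abs_nonneg _) this 2
    · rw [nsmul_eq_mul]
      gcongr
      exact (Finset.card_erase_le).trans (card_filter_val_lt_le n d)
  -- As `0 ≤ c ≤ 1`, `1 - c ≤ 1 - c²`, and `1 - c²` is the sum of the remaining squared
  -- coefficients.
  rw [abs_of_nonpos (by linarith)]
  nlinarith

end GramPerturbation

end Perturbation

/-! ### Hoeffding's inequality over finitely many outcomes. -/

section Bernoulli

theorem exp_mul_le_cosh_add_mul_sinh (u : ℝ) {y : ℝ} (h1 : -1 ≤ y) (h2 : y ≤ 1) :
    Real.exp (u * y) ≤ Real.cosh u + y * Real.sinh u := by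
  have h := convexOn_exp.2 (Set.mem_univ u) (Set.mem_univ (-u))
    (show 0 ≤ (1 + y) / 2 by linarith) (show 0 ≤ (1 - y) / 2 by linarith) (by ring)
  simp only [smul_eq_mul] at h
  rw [Real.cosh_eq, Real.sinh_eq]
  have e : u * y = (1 + y) / 2 * u + (1 - y) / 2 * -u := by ring
  rw [e]
  linarith

/-- The centred values `1 - p` and `-p` lie in `[-1, 1]`, and having mean zero cancels the `sinh`
terms of the chord bound. -/
theorem bernoulli_mgf_le {p : ℝ} (hp : p ∈ Set.Icc (0 : ℝ) 1) (u : ℝ) :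
    p * Real.exp (u * (1 - p)) + (1 - p) * Real.exp (u * (0 - p)) ≤ Real.exp (u ^ 2 / 2) := by
  obtain ⟨h0, h1⟩ := hp
  have e1 := exp_mul_le_cosh_add_mul_sinh u (y := 1 - p) (by linarith) (by linarith)
  have e2 := exp_mul_le_cosh_add_mul_sinh u (y := 0 - p) (by linarith) (by linarith)
  have e3 := mul_le_mul_of_nonneg_left e1 h0
  have e4 := mul_le_mul_of_nonneg_left e2 (show 0 ≤ 1 - p by linarith)
  calc _ ≤ _ := add_le_add e3 e4
    _ = Real.cosh u := by ring
    _ ≤ _ := Real.cosh_le_exp_half_sq u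

/-- Hoeffding's inequality for a weighted sum of independent centred Bernoulli variables, written
as a finite sum over all outcomes. -/
theorem bernoulli_weighted_sum_tail_le {T : Type*} [Fintype T] [DecidableEq T] {p w : T → ℝ}
    (hp : ∀ e, p e ∈ Set.Icc (0 : ℝ) 1) {S t : ℝ} (hS : ∑ e, w e ^ 2 ≤ S) (hS0 : 0 < S)
    (ht : 0 ≤ t) :
    ∑ a : T → Bool, (if t ≤ ∑ e, w e * ((if a e then 1 else 0) - p e) then
      ∏ e, (if a e then p e else 1 - p e) else 0) ≤ Real.exp (-t ^ 2 / (2 * S)) := by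
  -- The minimizer of the Chernoff exponent `-r t + r² S / 2`.
  set r := t / S with hr
  have hr0 : 0 ≤ r := div_nonneg ht hS0.le
  have hpa : ∀ a : T → Bool, 0 ≤ ∏ e, (if a e then p e else 1 - p e) := fun a =>
    Finset.prod_nonneg fun e _ => by
      split_ifs
      · exact (hp e).1
      · linarith [(hp e).2]
  calc _ ≤ ∑ a : T → Bool, Real.exp (-(r * t)) * ∏ e, ((if a e then p e else 1 - p e) *
        Real.exp (r * w e * ((if a e then 1 else 0) - p e))) := by
        refine Finset.sum_le_sum fun a _ => ?_
        rw [Finset.prod_mul_distrib, ← Real.exp_sum, mul_left_comm, ← Real.exp_add]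
        split_ifs with h
        · refine le_mul_of_one_le_right (hpa a) (Real.one_le_exp ?_)
          have := mul_le_mul_of_nonneg_left h hr0
          rw [Finset.mul_sum] at this
          simp only [mul_assoc] at this ⊢
          linarith
        · exact mul_nonneg (hpa a) (Real.exp_pos _).le
    _ = Real.exp (-(r * t)) * ∏ e, (p e * Real.exp (r * w e * (1 - p e)) +
          (1 - p e) * Real.exp (r * w e * (0 - p e))) := by
        rw [← Finset.mul_sum]
        congr 1
        have := Finset.prod_univ_sum (fun _ : T => (Finset.univ : Finset Bool))
          (fun e x => (if x then p e else 1 - p e) *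
            Real.exp (r * w e * ((if x then 1 else 0) - p e)))
        rw [Fintype.piFinset_univ] at this
        rw [← this]
        simp
    _ ≤ Real.exp (-(r * t)) * ∏ e, Real.exp ((r * w e) ^ 2 / 2) := by
        refine mul_le_mul_of_nonneg_left (Finset.prod_le_prod (fun e _ => ?_)
          fun e _ => bernoulli_mgf_le (hp e) _) (Real.exp_pos _).le
        have h1 := (hp e).1
        have h2 : 0 ≤ 1 - p e := by linarith [(hp e).2]
        positivity
    _ ≤ _ := by
        rw [← Real.exp_sum, ← Real.exp_add]
        refine Real.exp_le_exp.2 ?_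
        have e1 : ∑ e, (r * w e) ^ 2 / 2 = r ^ 2 / 2 * ∑ e, w e ^ 2 := by
          rw [Finset.mul_sum]
          exact Finset.sum_congr rfl fun e _ => by ring
        rw [e1]
        have e2 : r ^ 2 / 2 * ∑ e, w e ^ 2 ≤ r ^ 2 / 2 * S := by gcongr
        have e3 : -(r * t) + r ^ 2 / 2 * S = -t ^ 2 / (2 * S) := by
          rw [hr]; field_simp; ring
        linarith

end Bernoulli

/-! ### Edge probabilities conditional on the latent positions. -/

/-- The pairs `i < j` of vertices. -/
abbrev VertexPair (n : ℕ) := {e : Fin n × Fin n // e.1 < e.2}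

/-- The latent positions for which `X Xᵀ` is a matrix of probabilities. -/
def admissibleLatent (n d : ℕ) : Set (Fin n → EuclideanSpace ℝ (Fin d)) :=
  {x | ∀ i j, edgeProb x i j ∈ Set.Icc (0 : ℝ) 1}

theorem edgeProb_apply {n d : ℕ} (x : Fin n → EuclideanSpace ℝ (Fin d)) (i j : Fin n) :
    edgeProb x i j = ∑ k, x i k * x j k := by
  simp [edgeProb, latentMatrix, Matrix.mul_apply]

theorem edgeProb_eq_inner {n d : ℕ} (x : Fin n → EuclideanSpace ℝ (Fin d)) (i j : Fin n) :
    edgeProb x i j = inner ℝ (x i) (x j) := by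
  simp [edgeProb_apply, PiLp.inner_apply, mul_comm]

theorem measurable_latent_coord {n d : ℕ} (i : Fin n) (k : Fin d) :
    Measurable fun x : Fin n → EuclideanSpace ℝ (Fin d) => x i k :=
  (EuclideanSpace.proj (𝕜 := ℝ) k).continuous.measurable.comp (measurable_pi_apply i)

theorem measurable_edgeProb {n d : ℕ} (i j : Fin n) :
    Measurable fun x : Fin n → EuclideanSpace ℝ (Fin d) => edgeProb x i j := by
  simp only [edgeProb_apply]
  exact Finset.measurable_sum _ fun k _ =>
    (measurable_latent_coord i k).mul (measurable_latent_coord j k)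

theorem measurableSet_admissibleLatent (n d : ℕ) : MeasurableSet (admissibleLatent n d) := by
  have : admissibleLatent n d = ⋂ i, ⋂ j, (fun x => edgeProb x i j) ⁻¹' Set.Icc (0 : ℝ) 1 := by
    ext x; simp [admissibleLatent]
  rw [this]
  exact .iInter fun i => .iInter fun j => measurable_edgeProb i j measurableSet_Icc

section Conditional

variable {n d : ℕ} {Ω : Type*} [MeasurableSpace Ω] {μ : Measure Ω}
  {F : Measure (EuclideanSpace ℝ (Fin d))} {X : Ω → Fin n → EuclideanSpace ℝ (Fin d)}
  {A : Ω → Matrix (Fin n) (Fin n) ℝ}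

theorem IsRDPG.measurable (h : IsRDPG μ F X A) : Measurable X :=
  measurable_pi_iff.2 h.measurable_latent

variable [IsProbabilityMeasure μ]

/-- The conditional probability of a pattern of edges, integrated over an event of `X`. -/
theorem IsRDPG.measure_pattern_inter (h : IsRDPG μ F X A) (a : VertexPair n → Bool)
    {B : Set (Fin n → EuclideanSpace ℝ (Fin d))} (hB : MeasurableSet B) :
    Integrable (fun ω => ∏ e : VertexPair n, if a e then edgeProb (X ω) e.1.1 e.1.2
        else 1 - edgeProb (X ω) e.1.1 e.1.2) μ ∧
    μ.real (X ⁻¹' B ∩ {ω | ∀ e : VertexPair n, A ω e.1.1 e.1.2 = if a e then 1 else 0}) =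
      ∫ ω in X ⁻¹' B, ∏ e : VertexPair n, (if a e then edgeProb (X ω) e.1.1 e.1.2
        else 1 - edgeProb (X ω) e.1.1 e.1.2) ∂μ := by
  let a' : Fin n → Fin n → Bool := fun i j => if hij : i < j then a ⟨(i, j), hij⟩ else false
  have hcond := h.cond_law a'
  have hset : {ω | ∀ i j, i < j → A ω i j = if a' i j then 1 else 0} =
      {ω | ∀ e : VertexPair n, A ω e.1.1 e.1.2 = if a e then 1 else 0} := by
    ext ω
    constructor
    · intro hω e
      have := hω e.1.1 e.1.2 e.2
      simpa [a', e.2] using this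
    · intro hω i j hij
      have := hω ⟨(i, j), hij⟩
      simpa [a', hij] using this
  have hprod : ∀ ω, (∏ e : Fin n × Fin n with e.1 < e.2,
      if a' e.1 e.2 then edgeProb (X ω) e.1 e.2 else 1 - edgeProb (X ω) e.1 e.2) =
      ∏ e : VertexPair n, if a e then edgeProb (X ω) e.1.1 e.1.2
        else 1 - edgeProb (X ω) e.1.1 e.1.2 := by
    intro ω
    rw [Finset.prod_subtype (p := fun e : Fin n × Fin n => e.1 < e.2) _ (by simp)]
    refine Finset.prod_congr rfl fun e _ => ?_
    simp [a', e.2]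
  rw [hset] at hcond
  simp only [hprod] at hcond
  have hm : MeasurableSpace.comap X inferInstance ≤ (inferInstance : MeasurableSpace Ω) :=
    h.measurable.comap_le
  set Q := {ω | ∀ e : VertexPair n, A ω e.1.1 e.1.2 = if a e then 1 else 0} with hQ
  have hQm : MeasurableSet Q := by
    have : Q = ⋂ e : VertexPair n, (fun ω => A ω e.1.1 e.1.2) ⁻¹' {if a e then 1 else 0} := by
      ext ω; simp [hQ]
    rw [this]
    exact .iInter fun e => h.measurable_adj _ _ (measurableSet_singleton _)
  refine ⟨integrable_condExp.congr hcond, ?_⟩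
  have hBm : MeasurableSet[MeasurableSpace.comap X inferInstance] (X ⁻¹' B) := ⟨B, hB, rfl⟩
  rw [← integral_congr_ae (ae_restrict_of_ae hcond),
    setIntegral_condExp hm ((integrable_const 1).indicator hQm) hBm,
    integral_indicator_const _ hQm, measureReal_restrict_apply hQm, Set.inter_comm]
  simp

/-- Total probability over edge patterns. Letting `B` depend on the pattern covers events that
involve `X` and `A` jointly, and a bound for each fixed `x` becomes a bound on the measure. -/
theorem IsRDPG.measure_le_of_conditional (h : IsRDPG μ F X A)
    {B : (VertexPair n → Bool) → Set (Fin n → EuclideanSpace ℝ (Fin d))}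
    (hB : ∀ a, MeasurableSet (B a)) {c : ℝ}
    (hc : ∀ x, ∑ a, (B a).indicator (fun x => ∏ e : VertexPair n, if a e then
      edgeProb x e.1.1 e.1.2 else 1 - edgeProb x e.1.1 e.1.2) x ≤ c) :
    μ.real (⋃ a, (X ⁻¹' (B a) ∩ {ω | ∀ e : VertexPair n, A ω e.1.1 e.1.2 = if a e then 1 else 0}))
      ≤ c := by
  refine (measureReal_iUnion_fintype_le _).trans ?_
  have hint : ∀ a, MeasurableSet (X ⁻¹' (B a)) := fun a => h.measurable (hB a)
  calc _ = ∑ a, ∫ ω, (X ⁻¹' (B a)).indicator (fun ω => ∏ e : VertexPair n, (if a e then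
        edgeProb (X ω) e.1.1 e.1.2 else 1 - edgeProb (X ω) e.1.1 e.1.2)) ω ∂μ := by
        refine Finset.sum_congr rfl fun a _ => ?_
        rw [(h.measure_pattern_inter a (hB a)).2, integral_indicator (hint a)]
    _ = ∫ ω, ∑ a, (X ⁻¹' (B a)).indicator (fun ω => ∏ e : VertexPair n, (if a e then
        edgeProb (X ω) e.1.1 e.1.2 else 1 - edgeProb (X ω) e.1.1 e.1.2)) ω ∂μ := by
        rw [integral_finsetSum]
        exact fun a _ => (h.measure_pattern_inter a (hB a)).1.indicator (hint a)
    _ ≤ ∫ _, c ∂μ := by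
        refine integral_mono (integrable_finsetSum _ fun a _ =>
          (h.measure_pattern_inter a (hB a)).1.indicator (hint a)) (integrable_const c) fun ω => ?_
        exact hc (X ω)
    _ = c := by simp

/-- Conditional Hoeffding inequality for the edges, with weights depending on the latent
positions. -/
theorem IsRDPG.measure_weighted_sum_ge_le (h : IsRDPG μ F X A)
    {w : (Fin n → EuclideanSpace ℝ (Fin d)) → VertexPair n → ℝ}
    (hw : ∀ e, Measurable fun x => w x e) {S t : ℝ}
    (hS : ∀ x ∈ admissibleLatent n d, ∑ e, w x e ^ 2 ≤ S) (hS0 : 0 < S) (ht : 0 ≤ t) :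
    μ.real {ω | X ω ∈ admissibleLatent n d ∧
      t ≤ ∑ e, w (X ω) e * (A ω e.1.1 e.1.2 - edgeProb (X ω) e.1.1 e.1.2)} ≤
      Real.exp (-t ^ 2 / (2 * S)) := by
  classical
  -- Outside `admissibleLatent` the products need not be probabilities, so such positions are cut
  -- out.
  let B : (VertexPair n → Bool) → Set (Fin n → EuclideanSpace ℝ (Fin d)) := fun a =>
    admissibleLatent n d ∩
      {x | t ≤ ∑ e, w x e * ((if a e then 1 else 0) - edgeProb x e.1.1 e.1.2)}
  have hB : ∀ a, MeasurableSet (B a) := fun a =>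
    (measurableSet_admissibleLatent n d).inter <| measurableSet_le measurable_const <|
      Finset.measurable_sum _ fun e _ => (hw e).mul (measurable_const.sub (measurable_edgeProb _ _))
  refine le_trans (measureReal_mono ?_) (h.measure_le_of_conditional hB fun x => ?_)
  · rintro ω ⟨hω, htω⟩
    rw [Set.mem_iUnion]
    have hA : ∀ e : VertexPair n,
        A ω e.1.1 e.1.2 = if decide (A ω e.1.1 e.1.2 = 1) then 1 else 0 := by
      intro e
      rcases h.zero_or_one ω e.1.1 e.1.2 with h0 | h0 <;> simp [h0]
    refine ⟨fun e => decide (A ω e.1.1 e.1.2 = 1), ⟨hω, ?_⟩, hA⟩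
    refine htω.trans (le_of_eq (Finset.sum_congr rfl fun e _ => ?_))
    rw [← hA e]
  · by_cases hx : x ∈ admissibleLatent n d
    · refine le_trans (le_of_eq (Finset.sum_congr rfl fun a _ => ?_))
        (bernoulli_weighted_sum_tail_le (p := fun e : VertexPair n => edgeProb x e.1.1 e.1.2)
          (w := w x) (fun e => hx _ _) (hS x hx) hS0 ht)
      simp only [Set.indicator, B, Set.mem_inter_iff, hx, true_and, Set.mem_ofPred_eq]
    · refine le_trans (le_of_eq (Finset.sum_eq_zero fun a _ => ?_)) (Real.exp_pos _).le
      exact Set.indicator_of_notMem (fun hxB => hx hxB.1) _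

end Conditional

/-! ### Operator norm through a net. -/

section Net

open Module

/-- The ball of radius `2` has a `1`-net with at most `5 ^ dim` points. -/
theorem exists_finset_net (E : Type*) [NormedAddCommGroup E] [NormedSpace ℝ E]
    [FiniteDimensional ℝ E] :
    ∃ N : Finset E, N.card ≤ 5 ^ finrank ℝ E ∧ (∀ z ∈ N, ‖z‖ ≤ 2) ∧
      ∀ x : E, ‖x‖ ≤ 2 → ∃ z ∈ N, ‖x - z‖ ≤ 1 := by
  classical
  let p : Finset E → Prop := fun s =>
    (∀ z ∈ s, ‖z‖ ≤ 2) ∧ ∀ c ∈ s, ∀ e ∈ s, c ≠ e → 1 ≤ ‖c - e‖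
  let Q : ℕ → Prop := fun m => ∃ s, p s ∧ s.card = m
  have hbd : ∀ s, p s → s.card ≤ 5 ^ finrank ℝ E := fun s hs =>
    Besicovitch.card_le_of_separated s hs.1 hs.2
  have hQ0 : Q 0 := ⟨∅, by simp [p], rfl⟩
  -- A `1`-separated set of largest cardinality is a net: a point far from all of it could be added.
  obtain ⟨N, hN, hcard⟩ : Q (Nat.findGreatest Q (5 ^ finrank ℝ E)) :=
    Nat.findGreatest_spec (Nat.zero_le _) hQ0
  refine ⟨N, hbd N hN, hN.1, fun x hx => ?_⟩
  by_contra! hcon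
  have hxN : x ∉ N := fun hmem => by
    have := hcon x hmem
    simp at this
    linarith
  have hp : p (insert x N) := by
    refine ⟨fun z hz => ?_, fun c hc e he hce => ?_⟩
    · rcases Finset.mem_insert.1 hz with rfl | hz
      · exact hx
      · exact hN.1 z hz
    · rcases Finset.mem_insert.1 hc with rfl | hc1 <;>
        rcases Finset.mem_insert.1 he with rfl | he1
      · exact absurd rfl hce
      · exact (hcon e he1).le
      · rw [norm_sub_rev]; exact (hcon c hc1).le
      · exact hN.2 c hc1 e he1 hce
  have := Nat.le_findGreatest (P := Q) (hbd _ hp) ⟨_, hp, rfl⟩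
  rw [Finset.card_insert_of_notMem hxN] at this
  omega

/-- The operator norm is attained, up to a constant, on a net. -/
theorem opNorm_le_of_net {H : Type*} [NormedAddCommGroup H] [InnerProductSpace ℝ H]
    {N : Finset H} (hN : ∀ x : H, ‖x‖ ≤ 2 → ∃ z ∈ N, ‖x - z‖ ≤ 1)
    (T : H →L[ℝ] H) {t : ℝ} (ht : 0 ≤ t) (h : ∀ z ∈ N, ∀ z' ∈ N, inner ℝ z' (T z) ≤ t) :
    ‖T‖ ≤ t := by
  have h1 : ∀ z ∈ N, ‖T z‖ ≤ t := by
    intro z hz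
    rcases eq_or_ne (T z) 0 with h0 | h0
    · simpa [h0] using ht
    have hpos : 0 < ‖T z‖ := norm_pos_iff.2 h0
    -- Radius `2` against mesh `1`: testing on `2 T z / ‖T z‖` gives `2 ‖T z‖`, and the net error
    -- costs at most `‖T z‖`. The same trick in `x` then bounds `‖T‖`.
    obtain ⟨z', hz', hd⟩ := hN ((2 / ‖T z‖) • T z) (by
      rw [norm_smul, norm_div, norm_norm, div_mul_cancel₀ _ hpos.ne']
      simp)
    have e1 : inner ℝ ((2 / ‖T z‖) • T z) (T z) = 2 * ‖T z‖ := by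
      rw [inner_smul_left, real_inner_self_eq_norm_sq]
      simp
      field_simp
    have e2 : inner ℝ ((2 / ‖T z‖) • T z - z') (T z) ≤ 1 * ‖T z‖ :=
      (real_inner_le_norm _ _).trans (by gcongr)
    rw [inner_sub_left, e1] at e2
    linarith [h z hz z' hz']
  have h2 : ‖T‖ ≤ (t + ‖T‖) / 2 := by
    refine T.opNorm_le_bound (by positivity) fun x => ?_
    rcases eq_or_ne x 0 with rfl | h0
    · simp
    have hpos : 0 < ‖x‖ := norm_pos_iff.2 h0
    obtain ⟨z, hz, hd⟩ := hN ((2 / ‖x‖) • x) (by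
      rw [norm_smul, norm_div, norm_norm, div_mul_cancel₀ _ hpos.ne']
      simp)
    have e1 : ‖T ((2 / ‖x‖) • x)‖ = 2 / ‖x‖ * ‖T x‖ := by
      rw [map_smul, norm_smul, norm_div, norm_norm]
      simp
    have e2 : ‖T ((2 / ‖x‖) • x)‖ ≤ ‖T ((2 / ‖x‖) • x - z)‖ + ‖T z‖ := by
      rw [map_sub]
      exact norm_le_norm_sub_add _ _
    have e3 : ‖T ((2 / ‖x‖) • x - z)‖ ≤ ‖T‖ * 1 :=
      (T.le_opNorm _).trans (by gcongr)
    have e4 : 2 / ‖x‖ * ‖T x‖ ≤ t + ‖T‖ := by linarith [h1 z hz]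
    rw [div_mul_eq_mul_div, div_le_iff₀ hpos] at e4
    linarith
  linarith

end Net

/-! ### Concentration of the empirical second moments. -/

/-- Hoeffding's inequality for the empirical mean of independent `[-1, 1]`-valued variables. -/
theorem measure_abs_sum_sub_ge_le {n : ℕ} {Ω : Type*} [MeasurableSpace Ω] {μ : Measure Ω}
    [IsProbabilityMeasure μ] {Y : Fin n → Ω → ℝ} (hY : ∀ i, Measurable (Y i))
    (hind : iIndepFun Y μ) (hb : ∀ i, ∀ᵐ ω ∂μ, Y i ω ∈ Set.Icc (-1 : ℝ) 1) {m : ℝ}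
    (hm : ∀ i, ∫ ω, Y i ω ∂μ = m) {ε : ℝ} (hε : 0 ≤ ε) :
    μ.real {ω | n * ε ≤ |∑ i, Y i ω - n * m|} ≤ 2 * Real.exp (-(n * ε ^ 2 / 2)) := by
  have key : ∀ Z : Fin n → Ω → ℝ, iIndepFun Z μ → (∀ i, HasSubgaussianMGF (Z i) 1 μ) →
      μ.real {ω | n * ε ≤ ∑ i, Z i ω} ≤ Real.exp (-(n * ε ^ 2 / 2)) := by
    intro Z hZ hs
    have := HasSubgaussianMGF.measure_sum_ge_le_of_iIndepFun hZ (s := Finset.univ)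
      (fun i _ => hs i) (ε := n * ε) (by positivity)
    refine this.trans (Real.exp_le_exp.2 (le_of_eq ?_))
    rcases Nat.eq_zero_or_pos n with rfl | hn
    · simp
    · have : (0 : ℝ) < n := by exact_mod_cast hn
      simp
      field_simp
  have hsub : ∀ i, HasSubgaussianMGF (fun ω => Y i ω - m) 1 μ := by
    intro i
    have := hasSubgaussianMGF_of_mem_Icc (hY i).aemeasurable (hb i)
    rw [hm i] at this
    convert this using 1
    ext
    norm_num
  have h1 := key (fun i ω => Y i ω - m)
    (hind.comp (fun _ y => y - m) fun _ => measurable_id.sub_const m) hsub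
  have h2 := key (fun i ω => -(Y i ω - m))
    (hind.comp (fun _ y => -(y - m)) fun _ => (measurable_id.sub_const m).neg)
    (fun i => (hsub i).neg)
  calc _ ≤ μ.real ({ω | n * ε ≤ ∑ i, (Y i ω - m)} ∪ {ω | n * ε ≤ ∑ i, -(Y i ω - m)}) := by
        refine measureReal_mono fun ω hω => ?_
        have e1 : ∑ i, (Y i ω - m) = ∑ i, Y i ω - n * m := by simp
        have e2 : ∑ i, -(Y i ω - m) = -(∑ i, Y i ω - n * m) := by
          rw [Finset.sum_neg_distrib, e1]
        rcases le_abs.1 (show n * ε ≤ |∑ i, Y i ω - n * m| from hω) with h | h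
        · left; simpa only [Set.mem_ofPred_eq, e1] using h
        · right; simpa only [Set.mem_ofPred_eq, e2] using h
    _ ≤ _ := by
        refine (measureReal_union_le _ _).trans ?_
        linarith

section Latent

variable {n d : ℕ} {Ω : Type*} [MeasurableSpace Ω] {μ : Measure Ω}
  {F : Measure (EuclideanSpace ℝ (Fin d))} {X : Ω → Fin n → EuclideanSpace ℝ (Fin d)}
  {A : Ω → Matrix (Fin n) (Fin n) ℝ}

theorem IsRDPG.ae_admissible (h : IsRDPG μ F X A) (hF : IsLatentDistribution F) :
    ∀ᵐ ω ∂μ, X ω ∈ admissibleLatent n d := by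
  obtain ⟨-, 𝒳, h𝒳, hin⟩ := hF
  have : ∀ i, ∀ᵐ ω ∂μ, X ω i ∈ 𝒳 := fun i => by
    have h1 : ∀ᵐ x ∂(μ.map fun ω => X ω i), x ∈ 𝒳 := by rwa [h.law_latent i]
    exact ae_of_ae_map (h.measurable_latent i).aemeasurable h1
  filter_upwards [ae_all_iff.2 this] with ω hω i j
  rw [edgeProb_eq_inner]
  exact hin _ (hω i) _ (hω j)

theorem abs_coord_le_one {x : Fin n → EuclideanSpace ℝ (Fin d)} (hx : x ∈ admissibleLatent n d)
    (i : Fin n) (k : Fin d) : |x i k| ≤ 1 := by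
  have h1 := (hx i i).2
  rw [edgeProb_eq_inner, real_inner_self_eq_norm_sq] at h1
  have h2 : ‖x i‖ ≤ 1 := by
    refine (abs_le_of_sq_le_sq' ?_ zero_le_one).2
    simpa using h1
  exact (PiLp.norm_apply_le (x i) k).trans h2

variable [IsProbabilityMeasure μ]

theorem IsRDPG.measure_moment_deviation_le (h : IsRDPG μ F X A) (hF : IsLatentDistribution F)
    (k l : Fin d) {ε : ℝ} (hε : 0 ≤ ε) :
    μ.real {ω | n * ε ≤ |∑ i, X ω i k * X ω i l - n * secondMoment F k l|} ≤
      2 * Real.exp (-(n * ε ^ 2 / 2)) := by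
  have hg : Measurable fun x : EuclideanSpace ℝ (Fin d) => x k * x l :=
    ((EuclideanSpace.proj (𝕜 := ℝ) k).continuous.measurable).mul
      ((EuclideanSpace.proj (𝕜 := ℝ) l).continuous.measurable)
  refine measure_abs_sum_sub_ge_le (Y := fun i ω => X ω i k * X ω i l)
    (fun i => hg.comp (h.measurable_latent i))
    (h.indep_latent.comp (fun _ x => x k * x l) fun _ => hg) (fun i => ?_) (fun i => ?_) hε
  · filter_upwards [h.ae_admissible hF] with ω hω
    have h1 := abs_coord_le_one hω i k
    have h2 := abs_coord_le_one hω i l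
    rw [Set.mem_Icc, ← abs_le, abs_mul]
    exact mul_le_one₀ h1 (abs_nonneg _) h2
  · have h1 := integral_map (μ := μ) (h.measurable_latent i).aemeasurable
      (f := fun x : EuclideanSpace ℝ (Fin d) => x k * x l) hg.aestronglyMeasurable
    rw [h.law_latent i] at h1
    simp [secondMoment, h1]

end Latent

/-! ### Folding double sums onto the pairs `i < j`. -/

section PairSums

variable {n : ℕ}

theorem sum_sum_eq_sum_vertexPair {f : Fin n → Fin n → ℝ} (hf : ∀ i, f i i = 0) :
    ∑ i, ∑ j, f i j = ∑ e : VertexPair n, (f e.1.1 e.1.2 + f e.1.2 e.1.1) := by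
  have h1 : ∑ i, ∑ j, f i j = ∑ p : Fin n × Fin n, (if p.1 < p.2 then f p.1 p.2 else 0) +
      ∑ p : Fin n × Fin n, (if p.2 < p.1 then f p.1 p.2 else 0) := by
    rw [← Finset.sum_add_distrib, Fintype.sum_prod_type]
    refine Finset.sum_congr rfl fun i _ => Finset.sum_congr rfl fun j _ => ?_
    rcases lt_trichotomy i j with h | h | h
    · simp [h, h.not_gt]
    · simp [h, hf]
    · simp [h, h.not_gt]
  have h2 : ∑ p : Fin n × Fin n, (if p.2 < p.1 then f p.1 p.2 else 0) =
      ∑ p : Fin n × Fin n, (if p.1 < p.2 then f p.2 p.1 else 0) :=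
    Fintype.sum_equiv (Equiv.prodComm _ _) _ _ fun p => rfl
  rw [h1, h2, ← Finset.sum_add_distrib,
    ← Finset.sum_subtype (Finset.univ.filter fun p : Fin n × Fin n => p.1 < p.2) (by simp)
      (fun p => f p.1 p.2 + f p.2 p.1), Finset.sum_filter]
  refine Finset.sum_congr rfl fun p _ => ?_
  split_ifs <;> simp

theorem sum_vertexPair_le {g : Fin n → Fin n → ℝ} (hg : ∀ i j, 0 ≤ g i j) :
    ∑ e : VertexPair n, (g e.1.1 e.1.2 + g e.1.2 e.1.1) ≤ ∑ i, ∑ j, g i j := by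
  have h := sum_sum_eq_sum_vertexPair (f := fun i j => if i = j then 0 else g i j) (by simp)
  calc _ = ∑ i, ∑ j, (if i = j then 0 else g i j) := by
        rw [h]
        refine Finset.sum_congr rfl fun e _ => ?_
        rw [if_neg e.2.ne, if_neg e.2.ne']
    _ ≤ _ := by
        refine Finset.sum_le_sum fun i _ => Finset.sum_le_sum fun j _ => ?_
        split_ifs
        · exact hg i j
        · exact le_rfl

/-- Variance proxy for a bilinear form in a symmetric hollow matrix; the factor `2` arises because
each independent entry occurs twice. -/
theorem sum_vertexPair_sq_le (y z : Fin n → ℝ) :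
    ∑ e : VertexPair n, (y e.1.1 * z e.1.2 + y e.1.2 * z e.1.1) ^ 2 ≤
      2 * ((∑ i, y i ^ 2) * ∑ j, z j ^ 2) := by
  calc _ ≤ ∑ e : VertexPair n,
        (2 * (y e.1.1 ^ 2 * z e.1.2 ^ 2) + 2 * (y e.1.2 ^ 2 * z e.1.1 ^ 2)) := by
        refine Finset.sum_le_sum fun e _ => ?_
        nlinarith [sq_nonneg (y e.1.1 * z e.1.2 - y e.1.2 * z e.1.1)]
    _ ≤ ∑ i, ∑ j, 2 * (y i ^ 2 * z j ^ 2) :=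
        sum_vertexPair_le (g := fun i j => 2 * (y i ^ 2 * z j ^ 2)) fun i j => by positivity
    _ = _ := by
        rw [Finset.sum_mul_sum, Finset.mul_sum]
        simp_rw [Finset.mul_sum]

end PairSums

/-! ### Bilinear forms in the noise and the good event. -/

/-- The centred adjacency matrix: `A - P` with its diagonal removed. -/
noncomputable def centredAdj {n d : ℕ} (x : Fin n → EuclideanSpace ℝ (Fin d))
    (a : Matrix (Fin n) (Fin n) ℝ) : Matrix (Fin n) (Fin n) ℝ :=
  a - edgeProb x + Matrix.diagonal fun i => edgeProb x i i

section Forms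

variable {n d : ℕ} {Ω : Type*} [MeasurableSpace Ω] {μ : Measure Ω}
  {F : Measure (EuclideanSpace ℝ (Fin d))} {X : Ω → Fin n → EuclideanSpace ℝ (Fin d)}
  {A : Ω → Matrix (Fin n) (Fin n) ℝ}

theorem IsRDPG.form_eq_sum_vertexPair (h : IsRDPG μ F X A) (ω : Ω) (y z : Fin n → ℝ) :
    ∑ i, ∑ j, y i * centredAdj (X ω) (A ω) i j * z j = ∑ e : VertexPair n,
      (y e.1.1 * z e.1.2 + y e.1.2 * z e.1.1) *
        (A ω e.1.1 e.1.2 - edgeProb (X ω) e.1.1 e.1.2) := by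
  rw [sum_sum_eq_sum_vertexPair fun i => by simp [centredAdj, h.hollow]]
  refine Finset.sum_congr rfl fun e _ => ?_
  have h1 : A ω e.1.2 e.1.1 = A ω e.1.1 e.1.2 := (h.symm ω).apply _ _
  have h2 : edgeProb (X ω) e.1.2 e.1.1 = edgeProb (X ω) e.1.1 e.1.2 := by
    simp [edgeProb_apply, mul_comm]
  simp only [centredAdj, Matrix.add_apply, Matrix.sub_apply, Matrix.diagonal_apply_ne _ e.2.ne,
    Matrix.diagonal_apply_ne _ e.2.ne', h1, h2]
  ring

theorem IsRDPG.measurable_form (h : IsRDPG μ F X A)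
    {y z : (Fin n → EuclideanSpace ℝ (Fin d)) → Fin n → ℝ}
    (hy : ∀ i, Measurable fun x => y x i) (hz : ∀ i, Measurable fun x => z x i) :
    Measurable fun ω => ∑ i, ∑ j, y (X ω) i * centredAdj (X ω) (A ω) i j * z (X ω) j := by
  simp only [h.form_eq_sum_vertexPair]
  refine Finset.measurable_sum _ fun e _ => Measurable.mul ?_ ?_
  · exact (((hy _).comp h.measurable).mul ((hz _).comp h.measurable)).add
      (((hy _).comp h.measurable).mul ((hz _).comp h.measurable))
  · exact (h.measurable_adj _ _).sub ((measurable_edgeProb _ _).comp h.measurable)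

/-- The event on which the deterministic perturbation bounds apply. -/
def goodEvent (N : Finset (EuclideanSpace ℝ (Fin n))) (M : Matrix (Fin d) (Fin d) ℝ)
    (X : Ω → Fin n → EuclideanSpace ℝ (Fin d)) (A : Ω → Matrix (Fin n) (Fin n) ℝ)
    (ε t : ℝ) : Set Ω :=
  {ω | X ω ∈ admissibleLatent n d ∧
    (∀ k l, |∑ i, X ω i k * X ω i l - n * M k l| < n * ε) ∧
    (∀ z ∈ N, ∀ z' ∈ N,
      ∑ i, ∑ j, z' i * centredAdj (X ω) (A ω) i j * z j < 20 * √n) ∧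
    (∀ k l, |∑ i, ∑ j, X ω i k * centredAdj (X ω) (A ω) i j * X ω j l| < t)}

theorem IsRDPG.measurableSet_goodEvent (h : IsRDPG μ F X A)
    (N : Finset (EuclideanSpace ℝ (Fin n))) (M : Matrix (Fin d) (Fin d) ℝ) (ε t : ℝ) :
    MeasurableSet (goodEvent N M X A ε t) := by
  have hc := fun (i : Fin n) (k : Fin d) => (measurable_latent_coord i k).comp h.measurable
  have m1 := h.measurable (measurableSet_admissibleLatent n d)
  have m2 : MeasurableSet {ω | ∀ k l, |∑ i, X ω i k * X ω i l - n * M k l| < n * ε} := by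
    simp only [Set.ofPred_forall]
    refine .iInter fun k => .iInter fun l => measurableSet_lt ?_ measurable_const
    exact Measurable.abs ((Finset.measurable_sum _ fun i _ => (hc i k).mul (hc i l)).sub
      measurable_const)
  have m3 : MeasurableSet {ω | ∀ z ∈ N, ∀ z' ∈ N,
      ∑ i, ∑ j, z' i * centredAdj (X ω) (A ω) i j * z j < 20 * √n} := by
    simp only [Set.ofPred_forall]
    refine Finset.measurableSet_biInter _ fun z _ => Finset.measurableSet_biInter _ fun z' _ =>
      measurableSet_lt ?_ measurable_const
    exact h.measurable_form (y := fun _ i => z' i) (z := fun _ i => z i)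
      (fun _ => measurable_const) (fun _ => measurable_const)
  have m4 : MeasurableSet {ω | ∀ k l,
      |∑ i, ∑ j, X ω i k * centredAdj (X ω) (A ω) i j * X ω j l| < t} := by
    simp only [Set.ofPred_forall]
    refine .iInter fun k => .iInter fun l => measurableSet_lt (Measurable.abs ?_) measurable_const
    exact h.measurable_form (y := fun x i => x i k) (z := fun x i => x i l)
      (fun i => measurable_latent_coord i k) (fun i => measurable_latent_coord i l)
  exact m1.inter (m2.inter (m3.inter m4))

variable [IsProbabilityMeasure μ]

theorem IsRDPG.measure_form_ge_le (h : IsRDPG μ F X A)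
    {y z : (Fin n → EuclideanSpace ℝ (Fin d)) → Fin n → ℝ}
    (hy : ∀ i, Measurable fun x => y x i) (hz : ∀ i, Measurable fun x => z x i)
    {a b t : ℝ} (ha : 0 < a) (hb : 0 < b) (ht : 0 ≤ t)
    (hya : ∀ x ∈ admissibleLatent n d, ∑ i, y x i ^ 2 ≤ a)
    (hzb : ∀ x ∈ admissibleLatent n d, ∑ i, z x i ^ 2 ≤ b) :
    μ.real {ω | X ω ∈ admissibleLatent n d ∧
      t ≤ ∑ i, ∑ j, y (X ω) i * centredAdj (X ω) (A ω) i j * z (X ω) j} ≤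
      Real.exp (-(t ^ 2 / (4 * (a * b)))) := by
  simp only [h.form_eq_sum_vertexPair]
  refine (h.measure_weighted_sum_ge_le
    (w := fun x e => y x e.1.1 * z x e.1.2 + y x e.1.2 * z x e.1.1) (S := 2 * (a * b))
    (fun e => ((hy _).mul (hz _)).add ((hy _).mul (hz _))) (fun x hx => ?_)
    (by positivity) ht).trans (le_of_eq ?_)
  · refine (sum_vertexPair_sq_le _ _).trans ?_
    have h1 := hya x hx
    have h2 := hzb x hx
    have h3 : 0 ≤ ∑ i, z x i ^ 2 := Finset.sum_nonneg fun _ _ => sq_nonneg _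
    have := mul_le_mul h1 h2 h3 ha.le
    linarith
  · congr 1
    rw [neg_div]
    congr 2
    ring

/-- Union bound over moment entries, pairs of net points, and entries of the compressed noise with
both signs. Net pairs need one sign only, as `opNorm_le_of_net` asks for upper bounds alone. -/
theorem IsRDPG.measure_goodEvent_compl_le (h : IsRDPG μ F X A) (hF : IsLatentDistribution F)
    (hn : 0 < n) {N : Finset (EuclideanSpace ℝ (Fin n))} (hNcard : N.card ≤ 5 ^ n)
    (hN2 : ∀ z ∈ N, ‖z‖ ≤ 2) {ε t : ℝ} (hε : 0 ≤ ε) (ht : 0 ≤ t) :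
    μ.real (goodEvent N (secondMoment F) X A ε t)ᶜ ≤
      2 * d ^ 2 * Real.exp (-(n * ε ^ 2 / 2)) + 25 ^ n * Real.exp (-(25 / 4 * n)) +
        2 * d ^ 2 * Real.exp (-(t ^ 2 / (4 * (n * n)))) := by
  have hn' : (0 : ℝ) < n := by exact_mod_cast hn
  set Z0 := {ω | X ω ∉ admissibleLatent n d} with hZ0
  have h0 : μ.real Z0 = 0 := by
    have : μ Z0 = 0 := ae_iff.1 (h.ae_admissible hF)
    rw [measureReal_def, this]
    rfl
  let S1 : Fin d × Fin d → Set Ω := fun p =>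
    {ω | n * ε ≤ |∑ i, X ω i p.1 * X ω i p.2 - n * secondMoment F p.1 p.2|}
  have h1 : μ.real (⋃ p, S1 p) ≤ 2 * d ^ 2 * Real.exp (-(n * ε ^ 2 / 2)) := by
    refine (measureReal_iUnion_fintype_le _).trans ?_
    refine (Finset.sum_le_card_nsmul _ _ _ fun p _ =>
      h.measure_moment_deviation_le hF p.1 p.2 hε).trans (le_of_eq ?_)
    simp
    ring
  let S2 : N × N → Set Ω := fun p => {ω | X ω ∈ admissibleLatent n d ∧
    20 * √n ≤ ∑ i, ∑ j, p.2.1 i * centredAdj (X ω) (A ω) i j * p.1.1 j}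
  have hz4 : ∀ z ∈ N, ∑ i, z i ^ 2 ≤ 4 := by
    intro z hz
    rw [← EuclideanSpace.real_norm_sq_eq]
    nlinarith [hN2 z hz, norm_nonneg z]
  have h2 : μ.real (⋃ p, S2 p) ≤ 25 ^ n * Real.exp (-(25 / 4 * n)) := by
    refine (measureReal_iUnion_fintype_le _).trans ?_
    refine (Finset.sum_le_card_nsmul _ _ _ fun p _ =>
      h.measure_form_ge_le (y := fun _ i => p.2.1 i) (z := fun _ i => p.1.1 i)
        (fun _ => measurable_const) (fun _ => measurable_const) four_pos four_pos
        (by positivity) (fun _ _ => hz4 _ p.2.2) (fun _ _ => hz4 _ p.1.2)).trans ?_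
    rw [mul_pow, Real.sq_sqrt hn'.le, nsmul_eq_mul]
    -- The constant `20` makes this exponent beat the `25 ^ n` pairs of net points.
    have e1 : (20 : ℝ) ^ 2 * n / (4 * (4 * 4)) = 25 / 4 * n := by ring
    rw [e1]
    refine mul_le_mul_of_nonneg_right ?_ (Real.exp_pos _).le
    have e2 : (Finset.univ : Finset (N × N)).card ≤ 25 ^ n := by
      rw [Finset.card_univ, Fintype.card_prod, Fintype.card_coe]
      calc N.card * N.card ≤ 5 ^ n * 5 ^ n := Nat.mul_le_mul hNcard hNcard
        _ = 25 ^ n := by rw [← mul_pow]; norm_num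
    exact_mod_cast e2
  have hcol : ∀ x ∈ admissibleLatent n d, ∀ k, ∑ i, (x i k) ^ 2 ≤ (n : ℝ) := by
    intro x hx k
    calc ∑ i, (x i k) ^ 2 ≤ ∑ _i : Fin n, (1 : ℝ) := by
          refine Finset.sum_le_sum fun i _ => ?_
          rw [sq_le_one_iff_abs_le_one]
          exact abs_coord_le_one hx i k
      _ = n := by simp
  let S3 : Fin d × Fin d → Set Ω := fun p => {ω | X ω ∈ admissibleLatent n d ∧
    t ≤ ∑ i, ∑ j, X ω i p.1 * centredAdj (X ω) (A ω) i j * X ω j p.2}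
  have h3 : μ.real (⋃ p, S3 p) ≤ d ^ 2 * Real.exp (-(t ^ 2 / (4 * (n * n)))) := by
    refine (measureReal_iUnion_fintype_le _).trans ?_
    refine (Finset.sum_le_card_nsmul _ _ _ fun p _ =>
      h.measure_form_ge_le (y := fun x i => x i p.1) (z := fun x i => x i p.2)
        (fun i => measurable_latent_coord i p.1) (fun i => measurable_latent_coord i p.2) hn' hn'
        ht (fun x hx => hcol x hx p.1) (fun x hx => hcol x hx p.2)).trans (le_of_eq ?_)
    simp
    ring
  let S4 : Fin d × Fin d → Set Ω := fun p => {ω | X ω ∈ admissibleLatent n d ∧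
    t ≤ ∑ i, ∑ j, -X ω i p.1 * centredAdj (X ω) (A ω) i j * X ω j p.2}
  have h4 : μ.real (⋃ p, S4 p) ≤ d ^ 2 * Real.exp (-(t ^ 2 / (4 * (n * n)))) := by
    refine (measureReal_iUnion_fintype_le _).trans ?_
    refine (Finset.sum_le_card_nsmul _ _ _ fun p _ =>
      h.measure_form_ge_le (y := fun x i => -x i p.1) (z := fun x i => x i p.2)
        (fun i => (measurable_latent_coord i p.1).neg) (fun i => measurable_latent_coord i p.2)
        hn' hn' ht (fun x hx => by simpa using hcol x hx p.1)
        (fun x hx => hcol x hx p.2)).trans (le_of_eq ?_)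
    simp
    ring
  have hsub : (goodEvent N (secondMoment F) X A ε t)ᶜ ⊆
      Z0 ∪ ((⋃ p, S1 p) ∪ ((⋃ p, S2 p) ∪ ((⋃ p, S3 p) ∪ ⋃ p, S4 p))) := by
    intro ω hω
    by_contra hcon
    simp only [Set.mem_union, not_or, Set.mem_iUnion, not_exists] at hcon
    obtain ⟨c0, c1, c2, c3, c4⟩ := hcon
    have hadm : X ω ∈ admissibleLatent n d := not_not.1 c0
    refine hω ⟨hadm, fun k l => not_le.1 (c1 (k, l)), fun z hz z' hz' => ?_, fun k l => ?_⟩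
    · exact not_le.1 fun hle => c2 (⟨z, hz⟩, ⟨z', hz'⟩) ⟨hadm, hle⟩
    · rw [abs_lt]
      constructor
      · have : ¬ t ≤ ∑ i, ∑ j, -X ω i k * centredAdj (X ω) (A ω) i j * X ω j l :=
          fun hle => c4 (k, l) ⟨hadm, hle⟩
        simp only [neg_mul, Finset.sum_neg_distrib, not_le] at this
        linarith
      · exact not_le.1 fun hle => c3 (k, l) ⟨hadm, hle⟩
  refine (measureReal_mono hsub).trans ?_
  have u1 := measureReal_union_le (μ := μ) Z0
    ((⋃ p, S1 p) ∪ ((⋃ p, S2 p) ∪ ((⋃ p, S3 p) ∪ ⋃ p, S4 p)))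
  have u2 := measureReal_union_le (μ := μ) (⋃ p, S1 p)
    ((⋃ p, S2 p) ∪ ((⋃ p, S3 p) ∪ ⋃ p, S4 p))
  have u3 := measureReal_union_le (μ := μ) (⋃ p, S2 p) ((⋃ p, S3 p) ∪ ⋃ p, S4 p)
  have u4 := measureReal_union_le (μ := μ) (⋃ p, S3 p) (⋃ p, S4 p)
  linarith

end Forms

/-! ### From matrices to operators and orthonormal eigenbases. -/

section Bases

open Module

theorem Orthonormal.exists_orthonormalBasis_coe_eq {H : Type*} [NormedAddCommGroup H]
    [InnerProductSpace ℝ H] [FiniteDimensional ℝ H] {n : ℕ} {v : Fin n → H}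
    (hv : Orthonormal ℝ v) (hn : finrank ℝ H = n) :
    ∃ b : OrthonormalBasis (Fin n) ℝ H, ∀ i, b i = v i := by
  have hspan : ⊤ ≤ Submodule.span ℝ (Set.range v) := by
    rw [hv.linearIndependent.span_eq_top_of_card_eq_finrank' (by simp [hn])]
  exact ⟨OrthonormalBasis.mk hv hspan, fun i => by simp⟩

theorem ofLp_toEuclideanLin_eq_mulVec {m n : ℕ} (M : Matrix (Fin m) (Fin n) ℝ)
    (y : EuclideanSpace ℝ (Fin n)) : (Matrix.toEuclideanLin M y).ofLp = M.mulVec y.ofLp := by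
  rw [Matrix.toEuclideanLin, Matrix.toLpLin_apply]

theorem inner_toEuclideanLin {m n : ℕ} (M : Matrix (Fin m) (Fin n) ℝ)
    (x : EuclideanSpace ℝ (Fin m)) (y : EuclideanSpace ℝ (Fin n)) :
    inner ℝ x (Matrix.toEuclideanLin M y) = ∑ i, ∑ j, x i * M i j * y j := by
  simp only [PiLp.inner_apply, ofLp_toEuclideanLin_eq_mulVec, Matrix.mulVec, dotProduct]
  refine Finset.sum_congr rfl fun i _ => ?_
  rw [RCLike.inner_apply, conj_trivial, Finset.sum_mul]
  exact Finset.sum_congr rfl fun j _ => by ring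

theorem toEuclideanLin_mul_apply {l m n : ℕ} (M : Matrix (Fin l) (Fin m) ℝ)
    (M' : Matrix (Fin m) (Fin n) ℝ) (y : EuclideanSpace ℝ (Fin n)) :
    Matrix.toEuclideanLin (M * M') y = Matrix.toEuclideanLin M (Matrix.toEuclideanLin M' y) := by
  refine WithLp.ofLp_injective 2 ?_
  simp only [ofLp_toEuclideanLin_eq_mulVec, Matrix.mulVec_mulVec]

theorem inner_toEuclideanLin_left {m n : ℕ} (M : Matrix (Fin m) (Fin n) ℝ)
    (x : EuclideanSpace ℝ (Fin n)) (y : EuclideanSpace ℝ (Fin m)) :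
    inner ℝ (Matrix.toEuclideanLin M x) y = inner ℝ x (Matrix.toEuclideanLin M.transpose y) := by
  rw [real_inner_comm, inner_toEuclideanLin, inner_toEuclideanLin, Finset.sum_comm]
  refine Finset.sum_congr rfl fun i _ => Finset.sum_congr rfl fun j _ => ?_
  rw [Matrix.transpose_apply]
  ring

theorem sum_abs_le_sqrt_mul_norm {d : ℕ} (x : EuclideanSpace ℝ (Fin d)) :
    ∑ k, |x k| ≤ √d * ‖x‖ := by
  refine (abs_le_of_sq_le_sq' ?_ (by positivity)).2
  rw [mul_pow, Real.sq_sqrt (Nat.cast_nonneg d), EuclideanSpace.real_norm_sq_eq]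
  have := sq_sum_le_card_mul_sum_sq (s := (Finset.univ : Finset (Fin d))) (f := fun k => |x k|)
  simpa using this

/-- Turns entrywise concentration into a bound on forms at the cost of a factor `d`, by
Cauchy–Schwarz on the `ℓ¹` norms. -/
theorem abs_form_le_of_entries {d : ℕ} {M : Matrix (Fin d) (Fin d) ℝ} {m : ℝ}
    (hM : ∀ k l, |M k l| ≤ m) (hm : 0 ≤ m) (x y : EuclideanSpace ℝ (Fin d)) :
    |∑ k, ∑ l, x k * M k l * y l| ≤ m * d * ‖x‖ * ‖y‖ := by
  calc |∑ k, ∑ l, x k * M k l * y l| ≤ ∑ k, ∑ l, |x k| * m * |y l| := by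
        refine (Finset.abs_sum_le_sum_abs _ _).trans (Finset.sum_le_sum fun k _ => ?_)
        refine (Finset.abs_sum_le_sum_abs _ _).trans (Finset.sum_le_sum fun l _ => ?_)
        rw [abs_mul, abs_mul]
        gcongr
        exact hM k l
    _ = m * ((∑ k, |x k|) * ∑ l, |y l|) := by
        rw [Finset.sum_mul_sum, Finset.mul_sum]
        refine Finset.sum_congr rfl fun k _ => ?_
        rw [Finset.mul_sum]
        exact Finset.sum_congr rfl fun l _ => by ring
    _ ≤ m * ((√d * ‖x‖) * (√d * ‖y‖)) := by
        gcongr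
        · exact sum_abs_le_sqrt_mul_norm x
        · exact sum_abs_le_sqrt_mul_norm y
    _ = m * (√d * √d) * ‖x‖ * ‖y‖ := by ring
    _ = _ := by rw [Real.mul_self_sqrt (Nat.cast_nonneg d)]

/-- Eigenvectors of a symmetric matrix for distinct eigenvalues are orthogonal, and there are `d` of
them. -/
theorem exists_eigenbasis_secondMoment {d : ℕ} {F : Measure (EuclideanSpace ℝ (Fin d))}
    {δ : Fin d → ℝ} (hδ : Function.Injective δ)
    (h : ∀ k, End.HasEigenvalue (Matrix.toLin' (secondMoment F)) (δ k)) :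
    ∃ q : OrthonormalBasis (Fin d) ℝ (EuclideanSpace ℝ (Fin d)),
      ∀ k, Matrix.toEuclideanLin (secondMoment F) (q k) = δ k • q k := by
  have hsymm : (secondMoment F).transpose = secondMoment F := by
    ext k l
    simp [secondMoment, mul_comm]
  set T := Matrix.toEuclideanLin (secondMoment F) with hT
  have hex : ∀ k, ∃ v : EuclideanSpace ℝ (Fin d), ‖v‖ = 1 ∧ T v = δ k • v := by
    intro k
    obtain ⟨v, hv⟩ := (h k).exists_hasEigenvector
    have h1 : Matrix.mulVec (secondMoment F) v = δ k • v := by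
      simpa [Matrix.toLin'_apply] using hv.apply_eq_smul
    set u : EuclideanSpace ℝ (Fin d) := WithLp.toLp 2 v with hu
    have hu0 : u ≠ 0 := by
      intro h0
      exact hv.2 (by simpa [hu] using h0)
    have hTu : T u = δ k • u := by
      refine WithLp.ofLp_injective 2 ?_
      rw [hT, ofLp_toEuclideanLin_eq_mulVec, hu, h1]
      rfl
    refine ⟨(‖u‖)⁻¹ • u, ?_, ?_⟩
    · rw [norm_smul, norm_inv, norm_norm, inv_mul_cancel₀ (norm_ne_zero_iff.2 hu0)]
    · rw [map_smul, hTu, smul_comm]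
  choose v hv1 hv2 using hex
  have hon : Orthonormal ℝ v := by
    refine ⟨hv1, fun k l hkl => ?_⟩
    have h1 := inner_toEuclideanLin_left (secondMoment F) (v k) (v l)
    rw [hsymm, ← hT, hv2, hv2, inner_smul_left, inner_smul_right] at h1
    have h2 : (δ k - δ l) * inner ℝ (v k) (v l) = 0 := by
      simp only [conj_trivial] at h1
      linarith
    rcases mul_eq_zero.1 h2 with h3 | h3
    · exact absurd (hδ (sub_eq_zero.1 h3)) hkl
    · exact h3
  obtain ⟨q, hq⟩ := hon.exists_orthonormalBasis_coe_eq (by simp)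
  exact ⟨q, fun k => by rw [hq, hv2]⟩

/-- The whole basis is kept, since the residual is measured on the columns beyond the first `d`. -/
theorem IsTopEigenvectors.exists_orthonormalBasis {n d : ℕ} {M : Matrix (Fin n) (Fin n) ℝ}
    {V : Matrix (Fin n) (Fin d) ℝ} (h : IsTopEigenvectors M V) :
    ∃ (hdn : d ≤ n) (b : OrthonormalBasis (Fin n) ℝ (EuclideanSpace ℝ (Fin n))) (s : Fin n → ℝ),
      (∀ i, Matrix.toEuclideanLin M (b i) = s i • b i) ∧ (Antitone fun i => |s i|) ∧
      ∀ i k, V i k = b (Fin.castLE hdn k) i := by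
  obtain ⟨hdn, U, s, hU, hM, hs, hV⟩ := h
  have hUU : U.transpose * U = 1 := by
    have := (Matrix.mem_orthogonalGroup_iff' (Fin n) ℝ).1 hU
    simpa [Matrix.star_eq_conjTranspose] using this
  let v : Fin n → EuclideanSpace ℝ (Fin n) := fun i => WithLp.toLp 2 fun r => U r i
  have hon : Orthonormal ℝ v := by
    rw [orthonormal_iff_ite]
    intro i j
    have := congrFun (congrFun hUU i) j
    rw [Matrix.mul_apply, Matrix.one_apply] at this
    rw [← this]
    simp [v, PiLp.inner_apply, mul_comm]
  obtain ⟨b, hb⟩ := hon.exists_orthonormalBasis_coe_eq (by simp)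
  have hMU : M * U = U * Matrix.diagonal s := by
    rw [hM, Matrix.mul_assoc, hUU, Matrix.mul_one]
  refine ⟨hdn, b, s, fun i => ?_, hs, fun i k => by rw [hV, hb]⟩
  rw [hb]
  ext r
  have := congrFun (congrFun hMU r) i
  rw [Matrix.mul_apply, Matrix.mul_diagonal] at this
  simp only [ofLp_toEuclideanLin_eq_mulVec, Matrix.mulVec, dotProduct, v, PiLp.smul_apply,
    smul_eq_mul]
  rw [this, mul_comm]

end Bases

/-! ### The good event yields the perturbation data. -/

section GoodEvent

variable {n d : ℕ} {Ω : Type*}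
  {X : Ω → Fin n → EuclideanSpace ℝ (Fin d)} {A : Ω → Matrix (Fin n) (Fin n) ℝ}

/-- The net gives `20 √n` for the centred part; the diagonal of `P` has norm at most `1 ≤ √n`. -/
theorem norm_centred_sub_diagonal_le {x : Fin n → EuclideanSpace ℝ (Fin d)}
    (hx : x ∈ admissibleLatent n d) (hn : 0 < n) {a : Matrix (Fin n) (Fin n) ℝ}
    {N : Finset (EuclideanSpace ℝ (Fin n))}
    (hN : ∀ x : EuclideanSpace ℝ (Fin n), ‖x‖ ≤ 2 → ∃ z ∈ N, ‖x - z‖ ≤ 1)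
    (h : ∀ z ∈ N, ∀ z' ∈ N, ∑ i, ∑ j, z' i * centredAdj x a i j * z j < 20 * √n)
    (y : EuclideanSpace ℝ (Fin n)) :
    ‖Matrix.toEuclideanLin (a - edgeProb x) y‖ ≤ 21 * √n * ‖y‖ := by
  have h1 : ‖(Matrix.toEuclideanLin (centredAdj x a)).toContinuousLinearMap‖ ≤ 20 * √n :=
    opNorm_le_of_net hN _ (by positivity) fun z hz z' hz' => by
      rw [LinearMap.coe_toContinuousLinearMap', inner_toEuclideanLin]
      exact (h z hz z' hz').le
  have h2 : ‖Matrix.toEuclideanLin (centredAdj x a) y‖ ≤ 20 * √n * ‖y‖ :=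
    ((Matrix.toEuclideanLin (centredAdj x a)).toContinuousLinearMap.le_opNorm y).trans (by gcongr)
  have h3 : ‖Matrix.toEuclideanLin (Matrix.diagonal fun i => edgeProb x i i) y‖ ≤ ‖y‖ := by
    refine (abs_le_of_sq_le_sq' ?_ (norm_nonneg _)).2
    rw [EuclideanSpace.real_norm_sq_eq, EuclideanSpace.real_norm_sq_eq]
    refine Finset.sum_le_sum fun i _ => ?_
    rw [ofLp_toEuclideanLin_eq_mulVec, Matrix.mulVec_diagonal, mul_pow]
    exact mul_le_of_le_one_left (sq_nonneg _) (pow_le_one₀ (hx i i).1 (hx i i).2)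
  have h4 : a - edgeProb x = centredAdj x a - Matrix.diagonal fun i => edgeProb x i i := by
    rw [centredAdj, add_sub_cancel_right]
  have h5 : (1 : ℝ) ≤ √n := by
    rw [Real.one_le_sqrt]; exact_mod_cast hn
  rw [h4, map_sub, LinearMap.sub_apply]
  have h6 := mul_le_mul_of_nonneg_right h5 (norm_nonneg y)
  linarith [norm_sub_le (Matrix.toEuclideanLin (centredAdj x a) y)
    (Matrix.toEuclideanLin (Matrix.diagonal fun i => edgeProb x i i) y)]

theorem abs_compressed_noise_le {x : Fin n → EuclideanSpace ℝ (Fin d)}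
    (hx : x ∈ admissibleLatent n d) {a : Matrix (Fin n) (Fin n) ℝ} {t : ℝ} (k l : Fin d)
    (h : |∑ i, ∑ j, x i k * centredAdj x a i j * x j l| < t) :
    |((latentMatrix x).transpose * (a - edgeProb x) * latentMatrix x) k l| ≤ t + n := by
  have h1 : ((latentMatrix x).transpose * (a - edgeProb x) * latentMatrix x) k l =
      ∑ i, ∑ j, x i k * centredAdj x a i j * x j l - ∑ i, x i k * edgeProb x i i * x i l := by
    have h4 : a - edgeProb x = centredAdj x a - Matrix.diagonal fun i => edgeProb x i i := by
      rw [centredAdj, add_sub_cancel_right]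
    rw [h4, Matrix.mul_sub, Matrix.sub_mul, Matrix.sub_apply]
    congr 1
    · simp only [Matrix.mul_apply, latentMatrix, Matrix.transpose_apply, Matrix.of_apply,
        Finset.sum_mul]
      rw [Finset.sum_comm]
    · rw [Matrix.mul_apply]
      simp [Matrix.mul_diagonal, latentMatrix]
  have h2 : |∑ i, x i k * edgeProb x i i * x i l| ≤ n := by
    calc _ ≤ ∑ i : Fin n, (1 : ℝ) := by
          refine (Finset.abs_sum_le_sum_abs _ _).trans (Finset.sum_le_sum fun i _ => ?_)
          rw [abs_mul, abs_mul, abs_of_nonneg (hx i i).1]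
          exact mul_le_one₀ (mul_le_one₀ (abs_coord_le_one hx i k) (hx i i).1 (hx i i).2)
            (abs_nonneg _) (abs_coord_le_one hx i l)
      _ = n := by simp
  rw [h1]
  exact (abs_sub _ _).trans (add_le_add h.le h2)

/-- The tolerance `ε / d` per moment entry becomes `ε` for the form. In `τ`, the summand `n` next to
`t` pays for the diagonal of `P`. -/
theorem gramPerturbation_of_mem_goodEvent {N : Finset (EuclideanSpace ℝ (Fin n))}
    (hN : ∀ x : EuclideanSpace ℝ (Fin n), ‖x‖ ≤ 2 → ∃ z ∈ N, ‖x - z‖ ≤ 1)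
    {M : Matrix (Fin d) (Fin d) ℝ} {ε t : ℝ} {ω : Ω} (hd : 0 < d) (hdn : d ≤ n) (hε : 0 < ε)
    (ht : 0 ≤ t) (hω : ω ∈ goodEvent N M X A (ε / d) t)
    {q : OrthonormalBasis (Fin d) ℝ (EuclideanSpace ℝ (Fin d))}
    {b bh : OrthonormalBasis (Fin n) ℝ (EuclideanSpace ℝ (Fin n))} {s sh : Fin n → ℝ}
    {δ : Fin d → ℝ} (hq : ∀ k, Matrix.toEuclideanLin M (q k) = δ k • q k)
    (hb : ∀ i, Matrix.toEuclideanLin (edgeProb (X ω)) (b i) = s i • b i)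
    (hbh : ∀ i, Matrix.toEuclideanLin (A ω) (bh i) = sh i • bh i)
    (hs : Antitone fun i => |s i|) (hsh : Antitone fun i => |sh i|)
    (hδ : ∀ k, 8 * ε ≤ δ k) (hgap : ∀ k l, k < l → δ l + 8 * ε ≤ δ k)
    (hρ : 21 * √n ≤ n * ε) :
    GramPerturbation b bh q (Matrix.toEuclideanLin (latentMatrix (X ω)))
      (Matrix.toEuclideanLin (latentMatrix (X ω)).transpose) (Matrix.toEuclideanLin (A ω))
      (Matrix.toEuclideanLin M) s sh δ n ε (21 * √n) (d * ((t + n) / n)) := by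
  obtain ⟨hadm, hmom, hnet, hform⟩ := hω
  have hn : 0 < n := hd.trans_le hdn
  have hn' : (0 : ℝ) < n := by exact_mod_cast hn
  have hd' : (0 : ℝ) < d := by exact_mod_cast hd
  have hcomp : ∀ y, Matrix.toEuclideanLin (latentMatrix (X ω))
      (Matrix.toEuclideanLin (latentMatrix (X ω)).transpose y) =
      Matrix.toEuclideanLin (edgeProb (X ω)) y := fun y => by
    rw [← toEuclideanLin_mul_apply]; rfl
  have hnoise : ∀ y, Matrix.toEuclideanLin (A ω) y - Matrix.toEuclideanLin (edgeProb (X ω)) y =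
      Matrix.toEuclideanLin (A ω - edgeProb (X ω)) y := fun y => by
    rw [map_sub, LinearMap.sub_apply]
  refine ⟨hdn, inner_toEuclideanLin_left _, fun i => by rw [hcomp, hb], hbh, hs, hsh, hq, hn', hε,
    hδ, hgap, fun x => ?_, fun y => ?_, by positivity, hρ, by positivity, fun x y => ?_⟩
  · have h1 : ‖Matrix.toEuclideanLin (latentMatrix (X ω)) x‖ ^ 2 -
        n * inner ℝ x (Matrix.toEuclideanLin M x) = ∑ k, ∑ l, x k *
          ((latentMatrix (X ω)).transpose * latentMatrix (X ω) - (n : ℝ) • M) k l * x l := by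
      rw [← real_inner_self_eq_norm_sq, inner_toEuclideanLin_left, ← toEuclideanLin_mul_apply,
        ← inner_toEuclideanLin, map_sub, map_smul, LinearMap.sub_apply, inner_sub_right,
        LinearMap.smul_apply, inner_smul_right]
    rw [h1]
    refine (abs_form_le_of_entries (m := n * (ε / d)) (fun k l => ?_) (by positivity) x x).trans
      (le_of_eq ?_)
    · refine le_trans (le_of_eq ?_) (hmom k l).le
      simp [Matrix.mul_apply, latentMatrix]
    · field_simp
  · rw [hcomp, hnoise]
    exact norm_centred_sub_diagonal_le hadm hn hN hnet y
  · rw [hcomp, hnoise, inner_toEuclideanLin_left, ← toEuclideanLin_mul_apply,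
      ← toEuclideanLin_mul_apply, inner_toEuclideanLin]
    refine (abs_form_le_of_entries (m := t + n) (fun k l => ?_) (by positivity) x y).trans
      (le_of_eq ?_)
    · exact abs_compressed_noise_le hadm k l (hform k l)
    · field_simp

end GoodEvent

/-! ### Choice of constants and large-`n` estimates. -/

section Asymptotics

open Filter Topology

theorem exists_separation {d : ℕ} {δ : Fin d → ℝ} (hδ : StrictAnti δ) (hpos : ∀ k, 0 < δ k) :
    ∃ ε : ℝ, 0 < ε ∧ (∀ k, 8 * ε ≤ δ k) ∧ ∀ k l, k < l → δ l + 8 * ε ≤ δ k := by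
  have key : ∀ a : ℝ, 0 < a → ∀ᶠ ε in 𝓝[>] (0 : ℝ), 8 * ε ≤ a := by
    intro a ha
    filter_upwards [Ioo_mem_nhdsGT (show (0 : ℝ) < a / 8 by positivity)] with ε hε
    linarith [hε.2]
  have h1 : ∀ᶠ ε in 𝓝[>] (0 : ℝ), ∀ k, 8 * ε ≤ δ k :=
    eventually_all.2 fun k => key _ (hpos k)
  have h2 : ∀ᶠ ε in 𝓝[>] (0 : ℝ), ∀ k l, k < l → 8 * ε ≤ δ k - δ l :=
    eventually_all.2 fun k => eventually_all.2 fun l => by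
      by_cases hkl : k < l
      · filter_upwards [key _ (sub_pos.2 (hδ hkl))] with ε hε _ using hε
      · exact Eventually.of_forall fun ε h => absurd h hkl
  obtain ⟨ε, e1, e2, e3⟩ := (h1.and (h2.and self_mem_nhdsWithin)).exists
  exact ⟨ε, e3, e1, fun k l hkl => by linarith [e2 k l hkl]⟩

theorem twentyFive_mul_exp_le : 25 * Real.exp (-(25 / 4)) ≤ Real.exp (-1) := by
  have h1 : (2.7 : ℝ) ≤ Real.exp 1 := by linarith [Real.exp_one_gt_d9]
  have h2 : (25 : ℝ) ≤ Real.exp (21 / 4) := by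
    calc (25 : ℝ) ≤ 2.7 ^ 4 := by norm_num
      _ ≤ Real.exp 1 ^ 4 := by gcongr
      _ = Real.exp 4 := by rw [← Real.exp_nat_mul]; norm_num
      _ ≤ _ := Real.exp_le_exp.2 (by norm_num)
  calc 25 * Real.exp (-(25 / 4)) ≤ Real.exp (21 / 4) * Real.exp (-(25 / 4)) := by gcongr
    _ = Real.exp (-1) := by rw [← Real.exp_add]; norm_num

/-- Each term is eventually at most `n^(-c) / 3`: two decay exponentially, and the last equals `D
n^(-c) / n`, which is why its exponent carries `c + 1`. -/
theorem eventually_failure_le (c D : ℝ) {b : ℝ} (hb : 0 < b) :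
    ∀ᶠ n : ℕ in atTop, D * Real.exp (-(n * b)) + 25 ^ n * Real.exp (-(25 / 4 * n)) +
      D * Real.exp (-((c + 1) * Real.log n)) ≤ (n : ℝ) ^ (-c) := by
  have t1 : Tendsto (fun n : ℕ => D * ((n : ℝ) ^ c * Real.exp (-b * n))) atTop (𝓝 (D * 0)) :=
    ((tendsto_rpow_mul_exp_neg_mul_atTop_nhds_zero c b hb).comp
      tendsto_natCast_atTop_atTop).const_mul D
  have t2 : Tendsto (fun n : ℕ => (n : ℝ) ^ c * Real.exp (-1 * n)) atTop (𝓝 0) :=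
    (tendsto_rpow_mul_exp_neg_mul_atTop_nhds_zero c 1 one_pos).comp tendsto_natCast_atTop_atTop
  have t3 : Tendsto (fun n : ℕ => D * (n : ℝ)⁻¹) atTop (𝓝 (D * 0)) :=
    (tendsto_inv_atTop_zero.comp tendsto_natCast_atTop_atTop).const_mul D
  rw [mul_zero] at t1 t3
  have h3 : (0 : ℝ) < 1 / 3 := by norm_num
  filter_upwards [t1.eventually_le_const h3, t2.eventually_le_const h3, t3.eventually_le_const h3,
    eventually_gt_atTop 0] with n e1 e2 e3 hn
  have hn' : (0 : ℝ) < n := by exact_mod_cast hn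
  have hpos : 0 < (n : ℝ) ^ (-c) := Real.rpow_pos_of_pos hn' _
  have hmul : (n : ℝ) ^ (-c) * (n : ℝ) ^ c = 1 := by
    rw [← Real.rpow_add hn']; simp
  have f1 : D * Real.exp (-(n * b)) ≤ (n : ℝ) ^ (-c) * (1 / 3) := by
    calc D * Real.exp (-(n * b)) = ((n : ℝ) ^ (-c) * (n : ℝ) ^ c) * (D * Real.exp (-b * n)) := by
          rw [hmul, one_mul]; congr 2; ring
      _ = (n : ℝ) ^ (-c) * (D * ((n : ℝ) ^ c * Real.exp (-b * n))) := by ring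
      _ ≤ _ := by gcongr
  have f2 : 25 ^ n * Real.exp (-(25 / 4 * n)) ≤ (n : ℝ) ^ (-c) * (1 / 3) := by
    calc 25 ^ n * Real.exp (-(25 / 4 * n)) = (25 * Real.exp (-(25 / 4))) ^ n := by
          rw [mul_pow, ← Real.exp_nat_mul]; congr 2; ring
      _ ≤ Real.exp (-1) ^ n := by gcongr; exact twentyFive_mul_exp_le
      _ = ((n : ℝ) ^ (-c) * (n : ℝ) ^ c) * Real.exp (-1 * n) := by
          rw [hmul, one_mul, ← Real.exp_nat_mul, mul_comm]
      _ = (n : ℝ) ^ (-c) * ((n : ℝ) ^ c * Real.exp (-1 * n)) := by ring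
      _ ≤ _ := by gcongr
  have f3 : D * Real.exp (-((c + 1) * Real.log n)) ≤ (n : ℝ) ^ (-c) * (1 / 3) := by
    have e : Real.exp (-((c + 1) * Real.log n)) = (n : ℝ) ^ (-c) * (n : ℝ)⁻¹ := by
      rw [← Real.rpow_neg_one, ← Real.rpow_add hn', Real.rpow_def_of_pos hn']
      congr 1; ring
    calc _ = (n : ℝ) ^ (-c) * (D * (n : ℝ)⁻¹) := by rw [e]; ring
      _ ≤ _ := by gcongr
  linarith

theorem eventually_sqrt_le_mul {ε : ℝ} (hε : 0 < ε) :
    ∀ᶠ n : ℕ in atTop, 21 * √(n : ℝ) ≤ n * ε := by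
  have h := (Real.tendsto_sqrt_atTop.comp tendsto_natCast_atTop_atTop).eventually_ge_atTop (21 / ε)
  filter_upwards [h] with n hn
  have h1 : 21 / ε ≤ √(n : ℝ) := hn
  rw [div_le_iff₀ hε] at h1
  have h2 := Real.mul_self_sqrt (Nat.cast_nonneg (α := ℝ) n)
  calc 21 * √(n : ℝ) ≤ (√n * ε) * √n := by gcongr
    _ = (√n * √n) * ε := by ring
    _ = n * ε := by rw [h2]

/-- The perturbation bound is negligible with respect to `log n / n`. -/
theorem eventually_bound_le (D ε c g : ℝ) (hD : 0 < D) (hε : 0 < ε) (hg : 0 < g) :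
    ∀ᶠ n : ℕ in atTop, ∀ κ : ℝ,
      κ = (D * (D * ((n * √(4 * (c + 1) * Real.log n) + n) / n) / ε) +
        21 * √(n : ℝ) * (21 * √(n : ℝ) / (n * ε))) / (n * ε) →
      D * (κ + (D * κ ^ 2 + (21 * √(n : ℝ) / (n * ε)) ^ 2)) ≤ D * Real.log n / (g ^ 2 * n) := by
  -- Chosen so that `κ n ≤ γ √(log n)`; here `441 = 21²` comes from the residual.
  set γ := (D * D * (√(4 * (c + 1)) + 1) + 441) / ε ^ 2 with hγ
  have hγ0 : 0 ≤ γ := by positivity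
  -- The full entry bound times `n` is at most `Q √(log n)`; once `Q g² ≤ √(log n)`, the spare root
  -- absorbs every constant.
  set Q := γ + D * γ ^ 2 + 441 / ε ^ 2 with hQ
  have hQ0 : 0 ≤ Q := by positivity
  have hlim : Tendsto (fun n : ℕ => √(Real.log n)) atTop atTop :=
    Real.tendsto_sqrt_atTop.comp (Real.tendsto_log_atTop.comp tendsto_natCast_atTop_atTop)
  filter_upwards [hlim.eventually_ge_atTop 1, hlim.eventually_ge_atTop (Q * g ^ 2),
    eventually_gt_atTop 0] with n h1 h2 hn κ hκ
  have hn' : (0 : ℝ) < n := by exact_mod_cast hn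
  have hlog : 0 ≤ Real.log n := Real.log_natCast_nonneg n
  have hLn : Real.log n ≤ n := (Real.log_le_sub_one_of_pos hn').trans (by linarith)
  set L := Real.log n with hL
  have hLL : √L * √L = L := Real.mul_self_sqrt hlog
  have hL1 : √(4 * (c + 1) * L) ≤ √(4 * (c + 1)) * √L := by
    rw [Real.sqrt_mul' _ hlog]
  have hnn : √(n : ℝ) * √(n : ℝ) = n := Real.mul_self_sqrt hn'.le
  have hρ : 21 * √(n : ℝ) * (21 * √(n : ℝ) / (n * ε)) = 441 / ε := by
    calc _ = 441 * (√(n : ℝ) * √(n : ℝ)) / (n * ε) := by ring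
      _ = 441 / ε := by rw [hnn]; field_simp
  have hρ2 : (21 * √(n : ℝ) / (n * ε)) ^ 2 = 441 / ε ^ 2 / n := by
    calc _ = 441 * (√(n : ℝ) * √(n : ℝ)) / (n * ε) ^ 2 := by ring
      _ = _ := by rw [hnn]; field_simp
  have hκ1 : κ * n ≤ γ * √L := by
    have e1 : κ * n = (D * D * (√(4 * (c + 1) * L) + 1) + 441) / ε ^ 2 := by
      rw [hκ, hρ]; field_simp
    rw [e1, hγ, div_mul_eq_mul_div]
    gcongr
    have : D * D * (√(4 * (c + 1) * L) + 1) ≤ D * D * ((√(4 * (c + 1)) + 1) * √L) := by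
      gcongr
      linarith
    linarith
  have hκ0 : 0 ≤ κ := by rw [hκ, hρ]; positivity
  have hκ2 : κ ^ 2 * n ≤ γ ^ 2 := by
    have e1 : (κ * n) ^ 2 ≤ (γ * √L) ^ 2 := by gcongr
    have e2 : (γ * √L) ^ 2 ≤ γ ^ 2 * n := by
      rw [mul_pow, Real.sq_sqrt hlog]; gcongr
    refine le_of_mul_le_mul_right ?_ hn'
    calc κ ^ 2 * n * n = (κ * n) ^ 2 := by ring
      _ ≤ _ := e1.trans e2
  rw [hρ2, le_div_iff₀ (by positivity)]
  have hsum : (κ + (D * κ ^ 2 + 441 / ε ^ 2 / n)) * n ≤ Q * √L := by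
    have e1 : (κ + (D * κ ^ 2 + 441 / ε ^ 2 / n)) * n =
        κ * n + D * (κ ^ 2 * n) + 441 / ε ^ 2 := by field_simp; ring
    have e2 : D * (κ ^ 2 * n) ≤ D * γ ^ 2 * √L := by
      calc D * (κ ^ 2 * n) ≤ D * γ ^ 2 := by gcongr
        _ ≤ _ := le_mul_of_one_le_right (by positivity) h1
    have e3 : 441 / ε ^ 2 ≤ 441 / ε ^ 2 * √L := le_mul_of_one_le_right (by positivity) h1
    rw [e1, hQ]
    linarith
  calc D * (κ + (D * κ ^ 2 + 441 / ε ^ 2 / n)) * (g ^ 2 * n)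
      = D * g ^ 2 * ((κ + (D * κ ^ 2 + 441 / ε ^ 2 / n)) * n) := by ring
    _ ≤ D * g ^ 2 * (Q * √L) := by gcongr
    _ = D * ((Q * g ^ 2) * √L) := by ring
    _ ≤ D * (√L * √L) := by gcongr
    _ = D * L := by rw [hLL]

end Asymptotics

/-! ### Assembly of the main theorem. -/

theorem frobenius_norm_le_of_entries {d : ℕ} {M : Matrix (Fin d) (Fin d) ℝ} {m : ℝ} (hm : 0 ≤ m)
    (h : ∀ k l, |M k l| ≤ m) : ‖M‖ ≤ d * m := by
  rw [Matrix.frobenius_norm_def, ← Real.sqrt_eq_rpow, Real.sqrt_le_left (by positivity)]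
  calc ∑ k, ∑ l, ‖M k l‖ ^ (2 : ℝ) ≤ ∑ _k : Fin d, ∑ _l : Fin d, m ^ 2 := by
        refine Finset.sum_le_sum fun k _ => Finset.sum_le_sum fun l _ => ?_
        rw [Real.rpow_two, Real.norm_eq_abs]
        exact pow_le_pow_left₀ (abs_nonneg _) (h k l) 2
    _ = (d * m) ^ 2 := by simp; ring

theorem mainTheorem5 :
    ∃ C : ℝ, 0 < C ∧
      ∀ (d : ℕ) (hd : 0 < d) (δ : Fin d → ℝ), StrictAnti δ → (∀ k, 0 < δ k) →
      ∀ c : ℝ, 0 < c →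
      ∃ n₀ : ℕ,
        ∀ F : Measure (EuclideanSpace ℝ (Fin d)), IsLatentDistribution F →
        -- the eigenvalues of the second moment matrix are `δ 0 > … > δ (d - 1) > 0`
        (∀ k, Module.End.HasEigenvalue (Matrix.toLin' (secondMoment F)) (δ k)) →
        ∀ n : ℕ, n₀ < n →
        ∀ η : ℝ, (n : ℝ) ^ (-c) < η → η < 1 / 2 →
        ∀ (Ω : Type*) [MeasurableSpace Ω] (μ : Measure Ω) [IsProbabilityMeasure μ]
          (X : Ω → Fin n → EuclideanSpace ℝ (Fin d)) (A : Ω → Matrix (Fin n) (Fin n) ℝ),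
        IsRDPG μ F X A →
        ∃ G : Set Ω, MeasurableSet G ∧ ENNReal.ofReal (1 - 2 * η) < μ G ∧
          ∀ ω ∈ G, ∀ V Vhat : Matrix (Fin n) (Fin d) ℝ,
            IsTopEigenvectors (edgeProb (X ω)) V →
            IsTopEigenvectors (A ω) Vhat →
            -- the signs of the eigenvectors are chosen coherently
            (∀ k, 0 ≤ ∑ i, V i k * Vhat i k) →
            -- `‖·‖` is the Frobenius norm
            ‖V.transpose * Vhat - 1‖ ≤
              C * d * Real.log (n / η) / (δ ⟨d - 1, by omega⟩ ^ 2 * n) := by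
  refine ⟨1, one_pos, fun d hd δ hδ hpos c hc => ?_⟩
  have hd' : (0 : ℝ) < d := by exact_mod_cast hd
  -- `ε` depends on `δ` alone, so `n₀` is uniform in `F`.
  obtain ⟨ε, hε, hεδ, hεgap⟩ := exists_separation hδ hpos
  set g := δ ⟨d - 1, by omega⟩ with hg
  have hg0 : 0 < g := hpos _
  obtain ⟨n₀, hn₀⟩ := Filter.eventually_atTop.1
    ((eventually_failure_le c (2 * d ^ 2) (b := (ε / d) ^ 2 / 2) (by positivity)).and
      ((eventually_sqrt_le_mul hε).and (eventually_bound_le d ε c g hd' hε hg0)))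
  refine ⟨n₀, fun F hF hev n hn η hη1 hη2 Ω _ μ _ X A h => ?_⟩
  obtain ⟨hfail, hρ, hbound⟩ := hn₀ n hn.le
  have hnpos : 0 < n := by omega
  have hn' : (0 : ℝ) < n := by exact_mod_cast hnpos
  have hη0 : 0 < η := (Real.rpow_pos_of_pos hn' _).trans hη1
  have hlog : 0 ≤ Real.log n := Real.log_natCast_nonneg n
  obtain ⟨N, hNcard, hN2, hN⟩ := exists_finset_net (EuclideanSpace ℝ (Fin n))
  rw [finrank_euclideanSpace_fin] at hNcard
  obtain ⟨q, hq⟩ := exists_eigenbasis_secondMoment hδ.injective hev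
  -- Solves `t² / (4 n²) = (c + 1) log n`, the exponent needed for the compressed noise.
  set t := n * √(4 * (c + 1) * Real.log n) with ht
  have ht0 : 0 ≤ t := by positivity
  have htsq : t ^ 2 / (4 * ((n : ℝ) * n)) = (c + 1) * Real.log n := by
    rw [ht, mul_pow, Real.sq_sqrt (by positivity)]
    field_simp
  have hmeas := h.measurableSet_goodEvent N (secondMoment F) (ε / d) t
  refine ⟨goodEvent N (secondMoment F) X A (ε / d) t, hmeas, ?_, ?_⟩
  · have hcompl := h.measure_goodEvent_compl_le hF hnpos hNcard hN2
      (show 0 ≤ ε / d by positivity) ht0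
    rw [htsq, mul_div_assoc] at hcompl
    rw [probReal_compl_eq_one_sub hmeas] at hcompl
    rw [ENNReal.ofReal_lt_iff_lt_toReal (by linarith) (measure_ne_top _ _), ← measureReal_def]
    linarith
  · intro ω hω V Vhat hV hVhat hsign
    obtain ⟨hdn, b, s, hb, hs, hVb⟩ := hV.exists_orthonormalBasis
    obtain ⟨_, bh, sh, hbh, hsh, hVbh⟩ := hVhat.exists_orthonormalBasis
    have hG := gramPerturbation_of_mem_goodEvent hN hd hdn hε ht0 hω hq hb hbh hs hsh hεδ hεgap hρ
    have hentry : ∀ k l, ∑ i, V i k * Vhat i l =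
        inner ℝ (b (Fin.castLE hdn k)) (bh (Fin.castLE hdn l)) := by
      intro k l
      simp [PiLp.inner_apply, hVb, hVbh, mul_comm]
    have hoff := fun (k l : Fin d) (hkl : k ≠ l) => hG.abs_inner_le hkl
    have hdiag := fun k : Fin d => hG.one_sub_inner_le (k := k) (by
      rw [← hentry]; exact hsign k)
    set κ := (d * (d * ((t + n) / n) / ε) + 21 * √(n : ℝ) * (21 * √(n : ℝ) / (n * ε))) / (n * ε)
      with hκ
    have hκ0 : 0 ≤ κ := by positivity
    have hm0 : 0 ≤ d * κ ^ 2 + (21 * √(n : ℝ) / (n * ε)) ^ 2 := by positivity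
    -- One bound for all entries: `κ` serves off the diagonal, the other summand on it.
    refine (frobenius_norm_le_of_entries
      (m := κ + (d * κ ^ 2 + (21 * √(n : ℝ) / (n * ε)) ^ 2)) (by positivity) fun k l => ?_).trans
      ((hbound κ rfl).trans ?_)
    · rw [Matrix.sub_apply, Matrix.mul_apply]
      simp only [Matrix.transpose_apply]
      rw [hentry]
      by_cases hkl : k = l
      · subst hkl
        rw [Matrix.one_apply_eq]
        linarith [hdiag k]
      · rw [Matrix.one_apply_ne hkl, sub_zero]
        linarith [hoff k l hkl]
    · rw [one_mul]
      have : Real.log n ≤ Real.log (n / η) :=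
        Real.log_le_log hn' ((le_div_iff₀ hη0).2 (by nlinarith))
      gcongr
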